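/- **Setting.** Let $U\subseteq\mathbb{R}^4$ be open (a coordinate neighbourhood in a four-dimensional space-time) with coordinates $(x^0,x^1,x^2,x^3)=(t,x^1,x^2,x^3)$, let $\mathbf m$ be a smooth background Riemannian metric on $U$, and let $(\mathbf g_\varepsilon)_{\varepsilon\in(0,1]}$ be smooth Lorentzian metrics on $U$ of signature $(-,+,+,+)$ such that, for some $M_0>0$, $\mathbf g_\varepsilon^{-1}(dt,dt)\le -1/M_0^2$ on $U$ for all sufficiently small $\varepsilon$. Assume condition (A) for every compact $K\subset U$, every $k\ge 0$ and all smooth vector fields $\eta_1,\dots,\eta_k$ on $U$, $$\sup_K\|\mathcal L_{\eta_1}\cdots\mathcal L_{\eta_k}\mathbf g_\varepsilon\|_{\mathbf m}=O(\varepsilon^{-k}),\qquad \sup_K\|\mathcal L_{\eta_1}\cdots\mathcal L_{\eta_k}\mathbf g_\varepsilon^{-1}\|_{\mathbf m}=O(\varepsilon^{-k})\qquad(\varepsilon\to0).$$ Put $\xi_a=-(dt)_a$, $\xi^a_\varepsilon=g_\varepsilon^{ab}\xi_b$, $V_\varepsilon=\sqrt{-\mathbf g_\varepsilon(\xi_\varepsilon,\xi_\varepsilon)}$,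 $\widehat\xi_a^\varepsilon=\xi_a/V_\varepsilon$, $e^\varepsilon_{ab}=g^\varepsilon_{ab}+2\widehat\xi^\varepsilon_a\widehat\xi^\varepsilon_b$ with inverse $e_\varepsilon^{ab}$, and let $\nabla^\varepsilon$ be the Levi-Civita connection of $\mathbf g_\varepsilon$. Let $\Omega\subseteq U$ be measurable with compact closure contained in $U$, let $\gamma>0$, and for $0\le\tau\le\gamma$ let $S_\tau=\{x\in\Omega: t(x)=\tau\}$, with the measure $\mu^\varepsilon_\tau=|\det \mathbf g_\varepsilon|^{1/2}\,dx^1dx^2dx^3$ (so $dt\wedge\mu_\tau^\varepsilon$ is the volume form of $\mathbf g_\varepsilon$). For $u\in C^\infty(U)$ and $k\ge0$ define $$|\nabla^{(j)}_\varepsilon u|^2=e_\varepsilon^{p_1q_1}\cdots e_\varepsilon^{p_jq_j}(\nabla^\varepsilon_{p_1}\cdots\nabla^\varepsilon_{p_j}u)(\nabla^\varepsilon_{q_1}\cdots\nabla^\varepsilon_{q_j}u),$$ $$\|u\|_{\nabla,k}^2=\sum_{j=0}^k\int_{S_\tau}|\nabla_\varepsilon^{(j)}u|^2\mu_\tau^\varepsilon,\qquad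 \|u\|_{\partial,k}^2=\sum_{j=0}^k\ \sum_{p_1,\dots,p_j=0}^{3}\int_{S_\tau}|\partial_{p_1}\cdots\partial_{p_j}u|^2\mu_\tau^\varepsilon$$ (norms depending on $\tau$ and $\varepsilon$; derivatives in all four coordinate directions), the tensors $T^{ab,0}_\varepsilon(u)=-\tfrac12 g_\varepsilon^{ab}u^2$ and, for $j\ge1$, $$T^{ab,j}_\varepsilon(u)=\bigl(g_\varepsilon^{ac}g_\varepsilon^{bd}-\tfrac12 g_\varepsilon^{ab}g_\varepsilon^{cd}\bigr)e_\varepsilon^{p_1q_1}\cdots e_\varepsilon^{p_{j-1}q_{j-1}}(\nabla^\varepsilon_c\nabla^\varepsilon_{p_1}\cdots\nabla^\varepsilon_{p_{j-1}}u)(\nabla^\varepsilon_d\nabla^\varepsilon_{q_1}\cdots\nabla^\varepsilon_{q_{j-1}}u),$$ and the energy integrals $E^k_{\tau,\varepsilon}(u)=\sum_{j=0}^k\int_{S_\tau}T^{ab,j}_\varepsilon(u)\,\xi_a\widehat\xi_b^\varepsilon\,\mu_\tau^\varepsilon$. **Lemma.** 1. There are constants $A,A'>0$ such that, for all sufficiently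 small $\varepsilon>0$, all $k\ge0$, all $\tau\in[0,\gamma]$ and all $u\in C^\infty(U)$, $$A'\,\|u\|_{\nabla,k}^2\le E^k_{\tau,\varepsilon}(u)\le A\,\|u\|_{\nabla,k}^2 .$$ 2. For each $k\ge1$ there are constants $B_k,B_k'>0$ such that, for all sufficiently small $\varepsilon>0$ (depending on $k$), all $\tau\in[0,\gamma]$ and all $u\in C^\infty(U)$, $$\|u\|_{\nabla,k}^2\le B_k'\sum_{j=1}^k\frac{1}{\varepsilon^{2(k-j)}}\|u\|_{\partial,j}^2,\qquad \|u\|_{\partial,k}^2\le B_k\sum_{j=1}^k\frac{1}{\varepsilon^{2(k-j)}}\|u\|_{\nabla,j}^2 .$$ For $k=0$ one has $\|u\|_{\nabla,0}^2=\|u\|_{\partial,0}^2$ for all $\varepsilon\in(0,1]$, $\tau\in[0,\gamma]$ and $u\in C^\infty(U)$. -/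

import Mathlib

open Filter Topology MeasureTheory
open scoped ContDiff Matrix

noncomputable section

namespace EnergySobolev

/-- Points of a four-dimensional coordinate neighbourhood, `x = (x⁰, x¹, x², x³)` with `x⁰ = t`. -/
abbrev Pt : Type := Fin 4 → ℝ

/-- Fields of `4 × 4` component matrices: `(0,2)`-tensor fields `T_{ab}` or `(2,0)`-tensor fields
`T^{ab}` in the coordinates `x^a`. -/
abbrev MatField : Type := Pt → Matrix (Fin 4) (Fin 4) ℝ

/-- The partial derivative `∂_a f`. -/
def pd (a : Fin 4) (f : Pt → ℝ) (x : Pt) : ℝ := fderiv ℝ f x (Pi.single a 1)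

/-! ### Metrics -/

/-- Symmetric matrices of signature `(-,+,+,+)`. -/
def IsLorentzMatrix (G : Matrix (Fin 4) (Fin 4) ℝ) : Prop :=
  G.IsSymm ∧ ∃ P : Matrix (Fin 4) (Fin 4) ℝ, IsUnit P.det ∧
    Pᵀ * G * P = Matrix.diagonal ![-1, 1, 1, 1]

/-- Smooth matrix-valued fields on `U`. -/
def SmoothField (U : Set Pt) (T : MatField) : Prop :=
  ∀ a b, ContDiffOn ℝ ∞ (fun x => T x a b) U

/-- Smooth Lorentzian metrics on `U`. -/
def IsLorentzMetric (U : Set Pt) (g : MatField) : Prop :=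
  SmoothField U g ∧ ∀ x ∈ U, IsLorentzMatrix (g x)

/-- Smooth Riemannian metrics on `U`. -/
def IsRiemannMetric (U : Set Pt) (m : MatField) : Prop :=
  SmoothField U m ∧ ∀ x ∈ U, (m x).PosDef

/-- The inverse metric `g^{ab}`. -/
def invMetric (g : MatField) : MatField := fun x => (g x)⁻¹

/-! ### Condition (A) -/

/-- The Lie derivative of a `(0,2)`-tensor field,
`(L_η T)_{ab} = η^c ∂_c T_{ab} + T_{cb} ∂_a η^c + T_{ac} ∂_b η^c`. -/
def lieDown (η : Pt → Pt) (T : MatField) : MatField := fun x => Matrix.of fun a b =>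
  ∑ c, (η x c * pd c (fun y => T y a b) x + T x c b * pd a (fun y => η y c) x
    + T x a c * pd b (fun y => η y c) x)

/-- The Lie derivative of a `(2,0)`-tensor field,
`(L_η T)^{ab} = η^c ∂_c T^{ab} - T^{cb} ∂_c η^a - T^{ac} ∂_c η^b`. -/
def lieUp (η : Pt → Pt) (T : MatField) : MatField := fun x => Matrix.of fun a b =>
  ∑ c, (η x c * pd c (fun y => T y a b) x - T x c b * pd c (fun y => η y a) x
    - T x a c * pd c (fun y => η y b) x)

/-- The fibre norm `‖T‖_m` of a `(0,2)`-tensor, `‖T‖_m² = m^{ac} m^{bd} T_{ab} T_{cd}`. -/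
def normDown (m T : MatField) (x : Pt) : ℝ :=
  Real.sqrt (∑ a, ∑ b, ∑ c, ∑ d,
    invMetric m x a c * invMetric m x b d * T x a b * T x c d)

/-- The fibre norm `‖T‖_m` of a `(2,0)`-tensor, `‖T‖_m² = m_{ac} m_{bd} T^{ab} T^{cd}`. -/
def normUp (m T : MatField) (x : Pt) : ℝ :=
  Real.sqrt (∑ a, ∑ b, ∑ c, ∑ d, m x a c * m x b d * T x a b * T x c d)

/-- Condition (A): on every compact `K ⊆ U` and for every tuple `η₁, …, η_k` of smooth vector
fields on `U`, the quantities `sup_K ‖L_{η₁} ⋯ L_{η_k} g_ε‖_m` and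
`sup_K ‖L_{η₁} ⋯ L_{η_k} g_ε⁻¹‖_m` are `O(ε^{-k})` as `ε → 0`. -/
def ConditionA (U : Set Pt) (m : MatField) (g : ℝ → MatField) : Prop :=
  ∀ K : Set Pt, IsCompact K → K ⊆ U →
  ∀ ηs : List (Pt → Pt), (∀ η ∈ ηs, ContDiffOn ℝ ∞ η U) →
    (∃ C : ℝ, ∀ᶠ ε in 𝓝[>] (0 : ℝ), ∀ x ∈ K,
      normDown m (ηs.foldr lieDown (g ε)) x ≤ C / ε ^ ηs.length) ∧
    (∃ C : ℝ, ∀ᶠ ε in 𝓝[>] (0 : ℝ), ∀ x ∈ K,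
      normUp m (ηs.foldr lieUp (invMetric (g ε))) x ≤ C / ε ^ ηs.length)

/-! ### Normal fields and the associated Riemannian metric -/

/-- The components of the covector field `dt`, where `t = x⁰`. -/
def dt : Fin 4 → ℝ := Pi.single 0 1

/-- The normal covector field `σ = -dt`, also written `ξ_a`. -/
def sigma : Fin 4 → ℝ := -dt

/-- `g⁻¹(dt, dt)`. -/
def invMetricDt (g : MatField) (x : Pt) : ℝ := ∑ a, ∑ b, invMetric g x a b * dt a * dt b

/-- The normal vector field `ξ^a`, determined by `σ = g(ξ, ·)`. -/
def xi (g : MatField) (x : Pt) (a : Fin 4) : ℝ := ∑ b, invMetric g x a b * sigma b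

/-- `V = (-g(ξ, ξ))^{1/2}`. -/
def lapse (g : MatField) (x : Pt) : ℝ :=
  Real.sqrt (-∑ a, ∑ b, g x a b * xi g x a * xi g x b)

/-- The normalised normal vector field `ξ / V`. -/
def xiHat (g : MatField) (x : Pt) (a : Fin 4) : ℝ := xi g x a / lapse g x

/-- The normalised normal covector field `g(ξ / V, ·)`. -/
def sigmaHat (g : MatField) (x : Pt) (b : Fin 4) : ℝ := ∑ a, g x a b * xiHat g x a

/-- The Riemannian metric `e = g + 2 σ̂ ⊗ σ̂`. -/
def eMetric (g : MatField) : MatField := fun x => Matrix.of fun a b =>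
  g x a b + 2 * sigmaHat g x a * sigmaHat g x b

/-! ### Covariant and partial derivatives -/

/-- The Christoffel symbols `Γ^d_{ab}` of `g`. -/
def christoffel (g : MatField) (d a b : Fin 4) (x : Pt) : ℝ :=
  (1 / 2) * ∑ c, invMetric g x d c *
    (pd a (fun y => g y b c) x + pd b (fun y => g y a c) x - pd c (fun y => g y a b) x)

/-- The components of the covariant derivative of a `(0,k)`-tensor field, new index first:
`∇_c T_I = ∂_c T_I - ∑_s Γ^d_{c I_s} T_{I_1 … d … I_k}`. -/
def covD (g : MatField) {k : ℕ} (T : (Fin k → Fin 4) → Pt → ℝ) :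
    (Fin (k + 1) → Fin 4) → Pt → ℝ := fun I x =>
  pd (I 0) (T (Fin.tail I)) x -
    ∑ s, ∑ d, christoffel g d (I 0) (Fin.tail I s) x * T (Function.update (Fin.tail I) s d) x

/-- The components `∇_{p_1} ⋯ ∇_{p_j} u`. -/
def nablaPow (g : MatField) (u : Pt → ℝ) : (j : ℕ) → (Fin j → Fin 4) → Pt → ℝ
  | 0 => fun _ => u
  | j + 1 => covD g (nablaPow g u j)

/-- The iterated partial derivatives `∂_{p_1} ⋯ ∂_{p_j} u`. -/
def pdPow (u : Pt → ℝ) : (j : ℕ) → (Fin j → Fin 4) → Pt → ℝ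
  | 0 => fun _ => u
  | j + 1 => fun p => pd (p 0) (pdPow u j (Fin.tail p))

/-- `e^{IJ} = e^{p_1 q_1} ⋯ e^{p_j q_j}`, where `e^{ab}` is the inverse of `e_{ab}`. -/
def eInvProd (g : MatField) {j : ℕ} (I J : Fin j → Fin 4) (x : Pt) : ℝ :=
  ∏ s, invMetric (eMetric g) x (I s) (J s)

/-- `|∇^{(j)} u|² = e^{IJ} (∇_I u) (∇_J u)`. -/
def nablaNormSq (g : MatField) (u : Pt → ℝ) (j : ℕ) (x : Pt) : ℝ :=
  ∑ I : Fin j → Fin 4, ∑ J : Fin j → Fin 4,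
    eInvProd g I J x * nablaPow g u j I x * nablaPow g u j J x

/-! ### Integration over the slices -/

/-- The integral of `f` over `S_τ = {x ∈ Ω : x⁰ = τ}` with respect to the three-form `μ_τ` with
`dt ∧ μ_τ = μ = |det g|^{1/2} dx⁰ ∧ dx¹ ∧ dx² ∧ dx³`, that is,
`μ_τ = |det g|^{1/2} dx¹ ∧ dx² ∧ dx³`. -/
def sliceIntegral (g : MatField) (Ω : Set Pt) (τ : ℝ) (f : Pt → ℝ) : ℝ :=
  ∫ y in {y : Fin 3 → ℝ | (Fin.cons τ y : Pt) ∈ Ω},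
    f (Fin.cons τ y) * Real.sqrt |(g (Fin.cons τ y)).det|

/-! ### Sobolev norms and energy integrals on the slices -/

/-- The Sobolev norm of order `k` on `S_τ` built from the covariant derivatives of `g`. -/
def covSobolev (g : MatField) (Ω : Set Pt) (τ : ℝ) (k : ℕ) (u : Pt → ℝ) : ℝ :=
  Real.sqrt (∑ j ∈ Finset.range (k + 1), sliceIntegral g Ω τ (nablaNormSq g u j))

/-- The Sobolev norm of order `k` on `S_τ` built from all partial derivatives (also the
`t`-derivatives). -/
def partialSobolev (g : MatField) (Ω : Set Pt) (τ : ℝ) (k : ℕ) (u : Pt → ℝ) : ℝ :=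
  Real.sqrt (∑ j ∈ Finset.range (k + 1), ∑ p : Fin j → Fin 4,
    sliceIntegral g Ω τ (fun x => |pdPow u j p x| ^ 2))

/-- The energy momentum tensors `T^{ab,k}(u)`. -/
def energyTensor (g : MatField) (u : Pt → ℝ) : ℕ → Pt → Fin 4 → Fin 4 → ℝ
  | 0 => fun x a b => -(1 / 2) * invMetric g x a b * u x ^ 2
  | k + 1 => fun x a b => ∑ c, ∑ d, ∑ I : Fin k → Fin 4, ∑ J : Fin k → Fin 4,
      (invMetric g x a c * invMetric g x b d
        - (1 / 2) * invMetric g x a b * invMetric g x c d) * eInvProd g I J x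
      * nablaPow g u (k + 1) (Fin.cons c I) x * nablaPow g u (k + 1) (Fin.cons d J) x

/-- The energy integrals `E^k_τ(u) = ∑_{j ≤ k} ∫_{S_τ} T^{ab,j}(u) ξ_a ξ̂_b μ_τ`. -/
def energy (g : MatField) (Ω : Set Pt) (τ : ℝ) (k : ℕ) (u : Pt → ℝ) : ℝ :=
  ∑ j ∈ Finset.range (k + 1), sliceIntegral g Ω τ
    (fun x => ∑ a, ∑ b, energyTensor g u j x a b * sigma a * sigmaHat g x b)

end EnergySobolev

end

open EnergySobolev

/-! Part 1 is a pointwise identity. Since `σ = V σ̂` and `σ̂(ξ̂) = -1`, contracting `T^{ab,j}` with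
`ξ_a ξ̂_b` turns its coefficient into `V/2 (g^{cd} + 2 ξ̂^c ξ̂^d) = V/2 e^{cd}`, so the energy
density is `V/2 |∇^{(j)}u|²` for every `j` (`energyDensity_eq`). As `V² = -g^{00}`, the bound on
`g⁻¹(dt,dt)` gives `V ≥ 1/M₀`, and condition (A) without derivatives bounds `V` above. Neither bound
involves `k`.

Part 2 counts powers of `1/ε`. For coordinate vector fields, condition (A) bounds the partial
derivatives of the components of `g` and `g⁻¹`, each derivative costing one power; hence `Γ` costs
one power, and each derivative of `Γ` one more. Replacing `∇` by `∂` or conversely therefore writes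
a derivative of order `j` as a combination of derivatives of orders `1 ≤ i ≤ j` with coefficients
`O(ε^{-(j-i)})` (`comb_nablaOps`, `comb_partialOps`). Order `0` never appears, because `∇u = ∂u` on
functions.

Squaring produces the weights `ε^{-2(j-i)}`. The entries of `e` and of its inverse are bounded
uniformly in `ε`, so `|∇^{(j)}u|²` is comparable to the sum of squares of components
(`tensorForm_le`, `sum_sq_le_tensorForm`). It remains to integrate over the slice and to sum over
`j` (`sum_range_le_sum_Icc`). -/

namespace EnergySobolev

/-! ### Quadratic forms on tensors induced by a matrix -/

lemma sum_cons {k : ℕ} (f : (Fin (k + 1) → Fin 4) → ℝ) :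
    ∑ I, f I = ∑ c, ∑ I : Fin k → Fin 4, f (Fin.cons c I) := by
  rw [← (Fin.consEquiv (fun _ : Fin (k + 1) => Fin 4)).sum_comp, Fintype.sum_prod_type]
  rfl

/-- The action of a matrix on the components of a tensor, `∑_J (∏_s M (I_s) (J_s)) T_J`. -/
noncomputable def tensorAct {j : ℕ} (M : Matrix (Fin 4) (Fin 4) ℝ) (T : (Fin j → Fin 4) → ℝ)
    (I : Fin j → Fin 4) : ℝ := ∑ J, (∏ s, M (I s) (J s)) * T J

/-- The quadratic form on tensors induced by a bilinear form. -/
noncomputable def tensorForm {j : ℕ} (M : Matrix (Fin 4) (Fin 4) ℝ) (T : (Fin j → Fin 4) → ℝ) : ℝ :=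
  ∑ I, ∑ J, (∏ s, M (I s) (J s)) * T I * T J

/-- Functoriality of the tensor power: a product of sums expands into a sum over multi-indices. -/
lemma sum_prod_mul_prod {j : ℕ} (M N : Matrix (Fin 4) (Fin 4) ℝ) (I K : Fin j → Fin 4) :
    ∑ J : Fin j → Fin 4, (∏ s, M (I s) (J s)) * ∏ s, N (J s) (K s) =
      ∏ s, (M * N) (I s) (K s) := by
  simp only [Matrix.mul_apply, Fintype.prod_sum, Finset.prod_mul_distrib]

lemma tensorAct_mul {j : ℕ} (M N : Matrix (Fin 4) (Fin 4) ℝ) (T : (Fin j → Fin 4) → ℝ) :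
    tensorAct M (tensorAct N T) = tensorAct (M * N) T := by
  funext I
  simp only [tensorAct, Finset.mul_sum, ← sum_prod_mul_prod, Finset.sum_mul]
  rw [Finset.sum_comm]
  exact Finset.sum_congr rfl fun _ _ => Finset.sum_congr rfl fun _ _ => by ring

lemma prod_one_apply {j : ℕ} (I J : Fin j → Fin 4) :
    ∏ s, (1 : Matrix (Fin 4) (Fin 4) ℝ) (I s) (J s) = if I = J then 1 else 0 := by
  split_ifs with h
  · subst h
    exact Finset.prod_eq_one fun s _ => Matrix.one_apply_eq (I s)
  · obtain ⟨s, hs⟩ := Function.ne_iff.1 h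
    exact Finset.prod_eq_zero (Finset.mem_univ s) (Matrix.one_apply_ne hs)

lemma tensorAct_one {j : ℕ} (T : (Fin j → Fin 4) → ℝ) : tensorAct 1 T = T := by
  funext I
  simp [tensorAct, prod_one_apply]

/-- Reduces forms on tensors of any rank to a factorisation of the `4 × 4` matrix. -/
lemma tensorForm_transpose_mul_self {j : ℕ} (B : Matrix (Fin 4) (Fin 4) ℝ)
    (T : (Fin j → Fin 4) → ℝ) : tensorForm (Bᵀ * B) T = ∑ I, tensorAct B T I ^ 2 := by
  simp only [tensorForm, tensorAct, sq, ← sum_prod_mul_prod, Finset.sum_mul, Finset.mul_sum]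
  rw [Finset.sum_congr rfl fun I _ => Finset.sum_comm, Finset.sum_comm]
  refine Finset.sum_congr rfl fun I _ => ?_
  rw [Finset.sum_comm]
  refine Finset.sum_congr rfl fun J _ => Finset.sum_congr rfl fun K _ => ?_
  simp only [Matrix.transpose_apply]
  ring

lemma prod_sq_le {j : ℕ} {M : Matrix (Fin 4) (Fin 4) ℝ} {c : ℝ}
    (hM : ∀ a b, M a b ^ 2 ≤ c) (I J : Fin j → Fin 4) : (∏ s, M (I s) (J s)) ^ 2 ≤ c ^ j := by
  rw [← Finset.prod_pow]
  calc ∏ s, M (I s) (J s) ^ 2 ≤ ∏ _s : Fin j, c :=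
        Finset.prod_le_prod (fun _ _ => sq_nonneg _) fun _ _ => hM _ _
    _ = c ^ j := by simp

/-- Cauchy–Schwarz in `J` gives `4^j c^j`; summing over the `4^j` multi-indices `I` gives the other
factor `4^j`. -/
lemma sum_tensorAct_sq_le {j : ℕ} {M : Matrix (Fin 4) (Fin 4) ℝ} {c : ℝ}
    (hM : ∀ a b, M a b ^ 2 ≤ c) (T : (Fin j → Fin 4) → ℝ) :
    ∑ I, tensorAct M T I ^ 2 ≤ (16 * c) ^ j * ∑ I, T I ^ 2 := by
  have h : ∀ I, tensorAct M T I ^ 2 ≤ (4 ^ j * c ^ j) * ∑ I, T I ^ 2 := fun I => by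
    refine (Finset.sum_mul_sq_le_sq_mul_sq _ _ _).trans ?_
    refine mul_le_mul_of_nonneg_right ?_ (Finset.sum_nonneg fun _ _ => sq_nonneg _)
    refine (Finset.sum_le_sum fun J _ => prod_sq_le hM I J).trans ?_
    simp
  have hc : 0 ≤ c := (sq_nonneg _).trans (hM 0 0)
  have hT : 0 ≤ ∑ I, T I ^ 2 := Finset.sum_nonneg fun _ _ => sq_nonneg _
  refine (Finset.sum_le_sum fun I _ => h I).trans ?_
  simp only [Finset.sum_const, Finset.card_univ, Fintype.card_fun, Fintype.card_fin, nsmul_eq_mul,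
    Nat.cast_pow, Nat.cast_ofNat]
  rw [← mul_assoc, ← mul_assoc, ← mul_pow, ← mul_pow]
  gcongr
  linarith

lemma exists_eq_transpose_mul_self {A : Matrix (Fin 4) (Fin 4) ℝ} (hA : A.PosSemidef) :
    ∃ B : Matrix (Fin 4) (Fin 4) ℝ, A = Bᵀ * B := by
  open scoped MatrixOrder Matrix.Norms.L2Operator in
  obtain ⟨B, hB⟩ := CStarAlgebra.nonneg_iff_eq_star_mul_self.1 hA.nonneg
  exact ⟨B, by rw [hB, Matrix.star_eq_conjTranspose, Matrix.conjTranspose_eq_transpose_of_trivial]⟩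

/-- A diagonal entry of `Bᵀ B` is the sum of the squares of a column of `B`. -/
lemma transpose_mul_self_sq_le {A B : Matrix (Fin 4) (Fin 4) ℝ} (h : A = Bᵀ * B) {c : ℝ}
    (hA : ∀ a b, |A a b| ≤ c) (a b : Fin 4) : B a b ^ 2 ≤ c := by
  have : B a b ^ 2 ≤ A b b := by
    rw [h, Matrix.mul_apply]
    simp only [Matrix.transpose_apply, ← sq]
    exact Finset.single_le_sum (f := fun i => B i b ^ 2) (fun _ _ => sq_nonneg _)
      (Finset.mem_univ a)
  exact this.trans ((le_abs_self _).trans (hA b b))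

lemma tensorForm_nonneg {A : Matrix (Fin 4) (Fin 4) ℝ} (hA : A.PosSemidef) {j : ℕ}
    (T : (Fin j → Fin 4) → ℝ) : 0 ≤ tensorForm A T := by
  obtain ⟨B, rfl⟩ := exists_eq_transpose_mul_self hA
  rw [tensorForm_transpose_mul_self]
  exact Finset.sum_nonneg fun _ _ => sq_nonneg _

lemma tensorForm_le {A : Matrix (Fin 4) (Fin 4) ℝ} (hA : A.PosSemidef) {c : ℝ}
    (hc : ∀ a b, |A a b| ≤ c) {j : ℕ} (T : (Fin j → Fin 4) → ℝ) :
    tensorForm A T ≤ (16 * c) ^ j * ∑ I, T I ^ 2 := by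
  obtain ⟨B, hB⟩ := exists_eq_transpose_mul_self hA
  have := sum_tensorAct_sq_le (transpose_mul_self_sq_le hB hc) T
  rwa [← tensorForm_transpose_mul_self, ← hB] at this

/-- Factor `A = Bᵀ B` and recover `T` by letting `B⁻¹` act on the transformed tensor. The entries of
`B⁻¹` are controlled because `A' = A⁻¹ = B⁻¹ (B⁻¹)ᵀ`. -/
lemma sum_sq_le_tensorForm {A A' : Matrix (Fin 4) (Fin 4) ℝ} (hA : A.PosSemidef) (h : A * A' = 1)
    {c : ℝ} (hc : ∀ a b, |A' a b| ≤ c) {j : ℕ} (T : (Fin j → Fin 4) → ℝ) :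
    ∑ I, T I ^ 2 ≤ (16 * c) ^ j * tensorForm A T := by
  obtain ⟨B, hB⟩ := exists_eq_transpose_mul_self hA
  have hBu : IsUnit B.det := by
    have := congrArg Matrix.det h
    rw [hB, Matrix.det_mul, Matrix.det_mul, Matrix.det_one, mul_assoc] at this
    rw [Matrix.det_transpose] at this
    exact IsUnit.of_mul_eq_one _ this
  have hA' : A' = (B⁻¹ᵀ)ᵀ * B⁻¹ᵀ := by
    have h2 : A' = A⁻¹ := (Matrix.inv_eq_right_inv h).symm
    rw [h2, hB, Matrix.mul_inv_rev, Matrix.transpose_transpose, Matrix.transpose_nonsing_inv]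
  have hb : ∀ a b, B⁻¹ a b ^ 2 ≤ c := fun a b => transpose_mul_self_sq_le hA' hc b a
  have := sum_tensorAct_sq_le hb (tensorAct B T)
  rwa [tensorAct_mul, Matrix.nonsing_inv_mul _ hBu, tensorAct_one,
    ← tensorForm_transpose_mul_self, ← hB] at this

/-! ### Lorentzian linear algebra -/

/-- The orthogonal complement of a unit timelike vector is spacelike, by Cauchy–Schwarz on the
spatial parts. -/
lemma minkowski_nonneg_of_orthogonal {p₀ p₁ p₂ p₃ y₀ y₁ y₂ y₃ : ℝ}
    (hp : -p₀ ^ 2 + p₁ ^ 2 + p₂ ^ 2 + p₃ ^ 2 = -1)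
    (hy : -p₀ * y₀ + p₁ * y₁ + p₂ * y₂ + p₃ * y₃ = 0) :
    0 ≤ -y₀ ^ 2 + y₁ ^ 2 + y₂ ^ 2 + y₃ ^ 2 := by
  have h1 : (p₁ * y₁ + p₂ * y₂ + p₃ * y₃) ^ 2 ≤
      (p₁ ^ 2 + p₂ ^ 2 + p₃ ^ 2) * (y₁ ^ 2 + y₂ ^ 2 + y₃ ^ 2) := by
    nlinarith [sq_nonneg (p₁ * y₂ - p₂ * y₁), sq_nonneg (p₁ * y₃ - p₃ * y₁),
      sq_nonneg (p₂ * y₃ - p₃ * y₂)]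
  have h2 : p₁ * y₁ + p₂ * y₂ + p₃ * y₃ = p₀ * y₀ := by linarith
  have h3 : p₁ ^ 2 + p₂ ^ 2 + p₃ ^ 2 = p₀ ^ 2 - 1 := by linarith
  rw [h2, h3] at h1
  have h4 : 0 < p₀ ^ 2 := by nlinarith [sq_nonneg p₁, sq_nonneg p₂, sq_nonneg p₃]
  have h5 : 0 ≤ p₀ ^ 2 * (-y₀ ^ 2 + y₁ ^ 2 + y₂ ^ 2 + y₃ ^ 2) := by
    nlinarith [sq_nonneg y₁, sq_nonneg y₂, sq_nonneg y₃]
  exact nonneg_of_mul_nonneg_right h5 h4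

/-- With `α = ⟨p, w⟩`, the vector `y = w + α p` is orthogonal to `p` and `⟨w, w⟩ = ⟨y, y⟩ - α²`, so
the expression equals `⟨y, y⟩ + α²`. -/
lemma minkowski_add_two_mul_sq_nonneg {p₀ p₁ p₂ p₃ w₀ w₁ w₂ w₃ : ℝ}
    (hp : -p₀ ^ 2 + p₁ ^ 2 + p₂ ^ 2 + p₃ ^ 2 = -1) :
    0 ≤ -w₀ ^ 2 + w₁ ^ 2 + w₂ ^ 2 + w₃ ^ 2 +
      2 * (-p₀ * w₀ + p₁ * w₁ + p₂ * w₂ + p₃ * w₃) ^ 2 := by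
  set α := -p₀ * w₀ + p₁ * w₁ + p₂ * w₂ + p₃ * w₃ with hα
  have h := minkowski_nonneg_of_orthogonal (y₀ := w₀ + α * p₀) (y₁ := w₁ + α * p₁)
    (y₂ := w₂ + α * p₂) (y₃ := w₃ + α * p₃) hp (by linear_combination α * hp - hα)
  have : -(w₀ + α * p₀) ^ 2 + (w₁ + α * p₁) ^ 2 + (w₂ + α * p₂) ^ 2 + (w₃ + α * p₃) ^ 2 =
      -w₀ ^ 2 + w₁ ^ 2 + w₂ ^ 2 + w₃ ^ 2 + α ^ 2 := by
    linear_combination α ^ 2 * hp - 2 * α * hα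
  nlinarith [sq_nonneg α]

lemma IsLorentzMatrix.isUnit_det {G : Matrix (Fin 4) (Fin 4) ℝ} (h : IsLorentzMatrix G) :
    IsUnit G.det := by
  obtain ⟨-, P, -, hP⟩ := h
  have := congrArg Matrix.det hP
  rw [Matrix.det_mul, Matrix.det_mul, Matrix.det_diagonal] at this
  simp only [Fin.prod_univ_four, Matrix.cons_val] at this
  refine isUnit_iff_ne_zero.2 fun h0 => ?_
  rw [h0] at this
  norm_num at this

lemma IsLorentzMatrix.inv_isSymm {G : Matrix (Fin 4) (Fin 4) ℝ} (h : IsLorentzMatrix G) :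
    G⁻¹.IsSymm := by
  rw [Matrix.IsSymm, Matrix.transpose_nonsing_inv, h.1]

lemma IsLorentzMatrix.exists_inv_eq {G : Matrix (Fin 4) (Fin 4) ℝ} (h : IsLorentzMatrix G) :
    ∃ P : Matrix (Fin 4) (Fin 4) ℝ, G⁻¹ = P * Matrix.diagonal ![-1, 1, 1, 1] * Pᵀ := by
  obtain ⟨-, P, hPu, hP⟩ := h
  have hD : (Matrix.diagonal ![-1, 1, 1, 1] : Matrix (Fin 4) (Fin 4) ℝ) *
      Matrix.diagonal ![-1, 1, 1, 1] = 1 := by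
    rw [Matrix.diagonal_mul_diagonal, ← Matrix.diagonal_one]
    congr 1
    funext i
    fin_cases i <;> simp
  refine ⟨P, Matrix.inv_eq_left_inv ?_⟩
  have h1 : (Matrix.diagonal ![-1, 1, 1, 1] * Pᵀ * G) * P = 1 := by
    rw [Matrix.mul_assoc, Matrix.mul_assoc, ← Matrix.mul_assoc Pᵀ, hP, hD]
  have h2 := mul_eq_one_comm.1 h1
  simpa only [Matrix.mul_assoc] using h2

/-! ### The unit normal, the metric `e` and the energy density -/

section Normal

variable {g : MatField} {x : Pt}

lemma sigma_zero : sigma 0 = -1 := by simp [sigma, dt]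

lemma sigma_of_ne {b : Fin 4} (hb : b ≠ 0) : sigma b = 0 := by simp [sigma, dt, hb]

lemma sum_mul_sigma (f : Fin 4 → ℝ) : ∑ b, f b * sigma b = -f 0 := by
  rw [Finset.sum_eq_single 0 (fun b _ hb => by rw [sigma_of_ne hb, mul_zero]) (by simp),
    sigma_zero, mul_neg_one]

lemma invMetricDt_eq : invMetricDt g x = invMetric g x 0 0 := by
  simp [invMetricDt, dt, Pi.single_apply, Finset.sum_ite_eq']

lemma xi_eq (a : Fin 4) : xi g x a = -invMetric g x a 0 := by
  rw [xi, sum_mul_sigma]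

lemma sum_mul_xi (hg : IsLorentzMatrix (g x)) (b : Fin 4) :
    ∑ a, g x a b * xi g x a = sigma b := by
  have h := congrFun (congrFun (Matrix.mul_nonsing_inv _ hg.isUnit_det) b) 0
  rw [Matrix.mul_apply] at h
  simp only [xi_eq, mul_neg, Finset.sum_neg_distrib, invMetric]
  have hs : ∀ a, g x a b = g x b a := fun a => hg.1.apply b a
  simp only [hs, h]
  by_cases hb : b = 0
  · subst hb; simp [sigma_zero]
  · rw [Matrix.one_apply_ne hb, sigma_of_ne hb, neg_zero]

/-- From `g(ξ, ·) = σ` follows `g(ξ, ξ) = σ(ξ) = g^{00}`. -/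
lemma lapse_eq (hg : IsLorentzMatrix (g x)) : lapse g x = Real.sqrt (-invMetric g x 0 0) := by
  rw [lapse]
  congr 2
  rw [Finset.sum_comm]
  simp only [← Finset.sum_mul, sum_mul_xi hg]
  simp only [mul_comm (sigma _), sum_mul_sigma, xi_eq, neg_neg]

lemma lapse_sq (hg : IsLorentzMatrix (g x)) (h : invMetric g x 0 0 < 0) :
    lapse g x ^ 2 = -invMetric g x 0 0 := by
  rw [lapse_eq hg, Real.sq_sqrt (by linarith)]

lemma lapse_pos (hg : IsLorentzMatrix (g x)) (h : invMetric g x 0 0 < 0) : 0 < lapse g x := by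
  rw [lapse_eq hg]
  exact Real.sqrt_pos.2 (by linarith)

lemma sigmaHat_eq (hg : IsLorentzMatrix (g x)) (b : Fin 4) :
    sigmaHat g x b = sigma b / lapse g x := by
  simp only [sigmaHat, xiHat, ← mul_div_assoc, ← Finset.sum_div, sum_mul_xi hg]

lemma sum_inv_mul_sigmaHat (hg : IsLorentzMatrix (g x)) (a : Fin 4) :
    ∑ b, invMetric g x a b * sigmaHat g x b = xiHat g x a := by
  simp only [sigmaHat_eq hg, ← mul_div_assoc, ← Finset.sum_div, xiHat, xi]

lemma sum_sigmaHat_mul_xiHat (hg : IsLorentzMatrix (g x)) (h : invMetric g x 0 0 < 0) :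
    ∑ a, sigmaHat g x a * xiHat g x a = -1 := by
  have h2 : ∑ a, xi g x a * sigma a = invMetric g x 0 0 := by
    rw [sum_mul_sigma, xi_eq, neg_neg]
  have h3 := lapse_sq hg h
  have h4 := (lapse_pos hg h).ne'
  simp only [sigmaHat_eq hg, xiHat, div_mul_div_comm, ← Finset.sum_div, mul_comm (sigma _), h2]
  rw [← sq, h3, div_neg, div_self h.ne]

/-- The candidate `g^{ab} + 2 ξ̂^a ξ̂^b` for the inverse of `e`. -/
noncomputable def eUp (g : MatField) (x : Pt) : Matrix (Fin 4) (Fin 4) ℝ := Matrix.of fun a b =>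
  invMetric g x a b + 2 * xiHat g x a * xiHat g x b

/-- The two cross terms contribute `4 σ̂_a ξ̂^b`, and the product of the rank-one parts contributes
`4 σ̂(ξ̂) σ̂_a ξ̂^b`; they cancel since `σ̂(ξ̂) = -1`. -/
lemma eMetric_mul_eUp (hg : IsLorentzMatrix (g x)) (h : invMetric g x 0 0 < 0) :
    eMetric g x * eUp g x = 1 := by
  have h1 := Matrix.mul_nonsing_inv _ hg.isUnit_det
  ext a b
  have h2 := congrFun (congrFun h1 a) b
  rw [Matrix.mul_apply] at h2 ⊢
  have h3 : ∑ c, g x a c * xiHat g x c = sigmaHat g x a := by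
    rw [sigmaHat]
    exact Finset.sum_congr rfl fun c _ => by rw [hg.1.apply c a]
  have h4 : ∑ c, sigmaHat g x c * invMetric g x c b = xiHat g x b := by
    rw [← sum_inv_mul_sigmaHat hg]
    refine Finset.sum_congr rfl fun c _ => ?_
    rw [mul_comm, invMetric, hg.inv_isSymm.apply b c]
  have h5 := sum_sigmaHat_mul_xiHat hg h
  have h6 : ∑ c, eMetric g x a c * eUp g x c b =
      ∑ c, g x a c * (g x)⁻¹ c b + 2 * (∑ c, g x a c * xiHat g x c) * xiHat g x b
      + 2 * sigmaHat g x a * (∑ c, sigmaHat g x c * invMetric g x c b)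
      + 4 * sigmaHat g x a * (∑ c, sigmaHat g x c * xiHat g x c) * xiHat g x b := by
    simp only [Finset.mul_sum, Finset.sum_mul, ← Finset.sum_add_distrib]
    refine Finset.sum_congr rfl fun c _ => ?_
    simp only [eMetric, eUp, Matrix.of_apply, invMetric]
    ring
  rw [h6, h2, h3, h4, h5]
  ring

lemma invMetric_eMetric (hg : IsLorentzMatrix (g x)) (h : invMetric g x 0 0 < 0) :
    invMetric (eMetric g) x = eUp g x :=
  Matrix.inv_eq_right_inv (eMetric_mul_eUp hg h)

/-- A congruence takes `g⁻¹` to the Minkowski form and `σ̂` to a unit timelike `p`; the form becomes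
`⟨w, w⟩ + 2 ⟨p, w⟩²`. -/
lemma eUp_posSemidef (hg : IsLorentzMatrix (g x)) (h : invMetric g x 0 0 < 0) :
    (eUp g x).PosSemidef := by
  refine Matrix.PosSemidef.of_dotProduct_mulVec_nonneg ?_ fun v => ?_
  · ext a b
    simp only [Matrix.conjTranspose_apply, star_trivial, eUp, Matrix.of_apply, invMetric,
      hg.inv_isSymm.apply a b]
    ring
  obtain ⟨P, hP⟩ := hg.exists_inv_eq
  set p := Pᵀ *ᵥ sigmaHat g x with hp
  set w := Pᵀ *ᵥ v with hw
  have hform : ∀ a b : Fin 4 → ℝ, a ⬝ᵥ ((g x)⁻¹ *ᵥ b) =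
      -(Pᵀ *ᵥ a) 0 * (Pᵀ *ᵥ b) 0 + (Pᵀ *ᵥ a) 1 * (Pᵀ *ᵥ b) 1 + (Pᵀ *ᵥ a) 2 * (Pᵀ *ᵥ b) 2
        + (Pᵀ *ᵥ a) 3 * (Pᵀ *ᵥ b) 3 := fun a b => by
    rw [hP, ← Matrix.mulVec_mulVec, ← Matrix.mulVec_mulVec, Matrix.dotProduct_mulVec,
      ← Matrix.mulVec_transpose]
    simp [dotProduct, Fin.sum_univ_four, Matrix.mulVec_diagonal]
  have hxi : (g x)⁻¹ *ᵥ sigmaHat g x = xiHat g x := by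
    funext a
    exact sum_inv_mul_sigmaHat hg a
  have h1 : -p 0 ^ 2 + p 1 ^ 2 + p 2 ^ 2 + p 3 ^ 2 = -1 := by
    have h2 := hform (sigmaHat g x) (sigmaHat g x)
    rw [hxi, ← hp] at h2
    have h3 : sigmaHat g x ⬝ᵥ xiHat g x = -1 := sum_sigmaHat_mul_xiHat hg h
    rw [h3] at h2
    linarith
  have h4 : v ⬝ᵥ xiHat g x = -p 0 * w 0 + p 1 * w 1 + p 2 * w 2 + p 3 * w 3 := by
    rw [← hxi, hform, ← hp, ← hw]
    ring
  have h5 : star v ⬝ᵥ (eUp g x *ᵥ v) = v ⬝ᵥ ((g x)⁻¹ *ᵥ v) + 2 * (v ⬝ᵥ xiHat g x) ^ 2 := by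
    simp only [dotProduct, Matrix.mulVec, eUp, Matrix.of_apply, invMetric, Pi.star_apply,
      star_trivial, Fin.sum_univ_four]
    ring
  rw [h5, hform, ← hw, h4]
  have := minkowski_add_two_mul_sq_nonneg (w₀ := w 0) (w₁ := w 1) (w₂ := w 2) (w₃ := w 3) h1
  linarith

/-- The contraction of the energy tensor with `ξ ⊗ ξ̂` yields half the lapse times `e^{cd}`. -/
lemma sum_energyTensor_coeff (hg : IsLorentzMatrix (g x)) (h : invMetric g x 0 0 < 0)
    (c d : Fin 4) :
    ∑ a, ∑ b, (invMetric g x a c * invMetric g x b d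
        - (1 / 2) * invMetric g x a b * invMetric g x c d) * sigma a * sigmaHat g x b =
      lapse g x / 2 * eUp g x c d := by
  have hV := (lapse_pos hg h).ne'
  have hs : ∀ a, sigma a = lapse g x * sigmaHat g x a := fun a => by
    rw [sigmaHat_eq hg]; field_simp
  have h1 : ∀ c, ∑ a, invMetric g x a c * sigmaHat g x a = xiHat g x c := fun c => by
    rw [← sum_inv_mul_sigmaHat hg]
    exact Finset.sum_congr rfl fun a _ => by rw [invMetric, hg.inv_isSymm.apply c a]
  have h3 : ∑ a, ∑ b, (invMetric g x a c * invMetric g x b d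
        - (1 / 2) * invMetric g x a b * invMetric g x c d) * sigma a * sigmaHat g x b =
      lapse g x * ((∑ a, invMetric g x a c * sigmaHat g x a) *
          (∑ b, invMetric g x b d * sigmaHat g x b)
        - 1 / 2 * invMetric g x c d *
          ∑ a, sigmaHat g x a * ∑ b, invMetric g x a b * sigmaHat g x b) := by
    rw [Finset.sum_mul_sum]
    simp only [Finset.mul_sum, ← Finset.sum_sub_distrib]
    refine Finset.sum_congr rfl fun a _ => Finset.sum_congr rfl fun b _ => ?_
    rw [hs a]
    ring
  -- Since `σ̂(ξ̂) = -1`, the trace term changes sign and leaves `ξ̂^c ξ̂^d + ½ g^{cd} = ½ e^{cd}`.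
  rw [h3, h1, h1]
  simp only [sum_inv_mul_sigmaHat hg, sum_sigmaHat_mul_xiHat hg h, eUp, Matrix.of_apply]
  ring

lemma nablaNormSq_eq_tensorForm (hg : IsLorentzMatrix (g x)) (h : invMetric g x 0 0 < 0)
    (u : Pt → ℝ) (j : ℕ) :
    nablaNormSq g u j x = tensorForm (eUp g x) (fun I => nablaPow g u j I x) := by
  simp only [nablaNormSq, tensorForm, eInvProd, invMetric_eMetric hg h]

lemma nablaNormSq_zero (u : Pt → ℝ) : nablaNormSq g u 0 x = u x ^ 2 := by
  simp [nablaNormSq, eInvProd, nablaPow, sq]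

/-- For `j ≥ 1` the contraction supplies the missing `e^{cd}` for the first pair of indices, the
others being paired by `e` already. For `j = 0` the sign comes from `σ̂(ξ̂) = -1`. -/
lemma energyDensity_eq (hg : IsLorentzMatrix (g x)) (h : invMetric g x 0 0 < 0)
    (u : Pt → ℝ) (j : ℕ) :
    ∑ a, ∑ b, energyTensor g u j x a b * sigma a * sigmaHat g x b =
      lapse g x / 2 * nablaNormSq g u j x := by
  cases j with
  | zero =>
    have hs : ∀ a, sigma a = lapse g x * sigmaHat g x a := fun a => by
      have hV := (lapse_pos hg h).ne'
      rw [sigmaHat_eq hg]; field_simp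
    have h3 : ∑ a, ∑ b, energyTensor g u 0 x a b * sigma a * sigmaHat g x b =
        -(1 / 2) * u x ^ 2 * lapse g x *
          ∑ a, sigmaHat g x a * ∑ b, invMetric g x a b * sigmaHat g x b := by
      simp only [Finset.mul_sum]
      refine Finset.sum_congr rfl fun a _ => Finset.sum_congr rfl fun b _ => ?_
      rw [hs a, energyTensor]
      ring
    rw [h3]
    simp only [sum_inv_mul_sigmaHat hg, sum_sigmaHat_mul_xiHat hg h, nablaNormSq_zero]
    ring
  | succ k =>
    have h1 : nablaNormSq g u (k + 1) x = ∑ c, ∑ d, ∑ I : Fin k → Fin 4, ∑ J : Fin k → Fin 4,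
        eUp g x c d * (eInvProd g I J x * nablaPow g u (k + 1) (Fin.cons c I) x *
          nablaPow g u (k + 1) (Fin.cons d J) x) := by
      rw [nablaNormSq, sum_cons]
      refine Finset.sum_congr rfl fun c _ => ?_
      simp only [sum_cons (k := k)]
      rw [Finset.sum_comm]
      refine Finset.sum_congr rfl fun d _ => Finset.sum_congr rfl fun I _ =>
        Finset.sum_congr rfl fun J _ => ?_
      simp only [eInvProd, Fin.prod_univ_succ, Fin.cons_zero, Fin.cons_succ,
        invMetric_eMetric hg h]
      ring
    have h2 : ∑ a, ∑ b, energyTensor g u (k + 1) x a b * sigma a * sigmaHat g x b =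
        ∑ c, ∑ d, ∑ I : Fin k → Fin 4, ∑ J : Fin k → Fin 4,
        (∑ a, ∑ b, (invMetric g x a c * invMetric g x b d
          - (1 / 2) * invMetric g x a b * invMetric g x c d) * sigma a * sigmaHat g x b) *
          (eInvProd g I J x * nablaPow g u (k + 1) (Fin.cons c I) x *
          nablaPow g u (k + 1) (Fin.cons d J) x) := by
      simp only [← Finset.mul_sum]
      simp only [Finset.sum_mul]
      simp only [energyTensor, Finset.sum_mul, Finset.mul_sum]
      have hc : ∀ F : Fin 4 → Fin 4 → Fin 4 → Fin 4 → ℝ,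
          ∑ a, ∑ b, ∑ c, ∑ d, F a b c d = ∑ c, ∑ d, ∑ a, ∑ b, F a b c d := fun F => by
        simp only [Fin.sum_univ_four]; ring
      rw [hc]
      refine Finset.sum_congr rfl fun c _ => Finset.sum_congr rfl fun d _ =>
        Finset.sum_congr rfl fun a _ => Finset.sum_congr rfl fun b _ =>
        Finset.sum_congr rfl fun I _ => Finset.sum_congr rfl fun J _ => ?_
      ring
    rw [h2, h1]
    simp only [sum_energyTensor_coeff hg h, Finset.mul_sum]
    refine Finset.sum_congr rfl fun c _ => Finset.sum_congr rfl fun d _ =>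
        Finset.sum_congr rfl fun I _ => Finset.sum_congr rfl fun J _ => ?_
    ring

lemma nablaNormSq_nonneg (hg : IsLorentzMatrix (g x)) (h : invMetric g x 0 0 < 0)
    (u : Pt → ℝ) (j : ℕ) : 0 ≤ nablaNormSq g u j x := by
  rw [nablaNormSq_eq_tensorForm hg h]
  exact tensorForm_nonneg (eUp_posSemidef hg h) _

end Normal

/-! ### Smoothness and partial derivatives on `U` -/

section Derivative

variable {U : Set Pt}

lemma contDiffOn_pd (hU : IsOpen U) {f : Pt → ℝ} (hf : ContDiffOn ℝ ∞ f U) (a : Fin 4) :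
    ContDiffOn ℝ ∞ (pd a f) U :=
  (hf.fderiv_of_isOpen hU (by simp)).clm_apply contDiffOn_const

lemma differentiableAt_of_smooth (hU : IsOpen U) {f : Pt → ℝ} (hf : ContDiffOn ℝ ∞ f U) {x : Pt}
    (hx : x ∈ U) : DifferentiableAt ℝ f x :=
  (hf.differentiableOn (by simp)).differentiableAt (hU.mem_nhds hx)

lemma pd_congr (hU : IsOpen U) {f h : Pt → ℝ} (hfh : ∀ x ∈ U, f x = h x) (a : Fin 4) {x : Pt}
    (hx : x ∈ U) : pd a f x = pd a h x := by
  rw [pd, pd, Filter.EventuallyEq.fderiv_eq (f := h)]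
  filter_upwards [hU.mem_nhds hx] with y hy using hfh y hy

lemma pd_const (a : Fin 4) (c : ℝ) (x : Pt) : pd a (fun _ => c) x = 0 := by
  simp [pd]

lemma pd_add (hU : IsOpen U) {f h : Pt → ℝ} (hf : ContDiffOn ℝ ∞ f U) (hh : ContDiffOn ℝ ∞ h U)
    (a : Fin 4) {x : Pt} (hx : x ∈ U) :
    pd a (fun y => f y + h y) x = pd a f x + pd a h x := by
  simp only [pd]
  rw [fderiv_fun_add (differentiableAt_of_smooth hU hf hx) (differentiableAt_of_smooth hU hh hx)]
  rfl

lemma pd_mul (hU : IsOpen U) {f h : Pt → ℝ} (hf : ContDiffOn ℝ ∞ f U) (hh : ContDiffOn ℝ ∞ h U)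
    (a : Fin 4) {x : Pt} (hx : x ∈ U) :
    pd a (fun y => f y * h y) x = pd a f x * h x + f x * pd a h x := by
  simp only [pd]
  rw [fderiv_fun_mul (differentiableAt_of_smooth hU hf hx) (differentiableAt_of_smooth hU hh hx)]
  simp only [add_apply, smul_apply, smul_eq_mul]
  ring

lemma contDiffOn_det {A : MatField} (hA : SmoothField U A) :
    ContDiffOn ℝ ∞ (fun x => (A x).det) U := by
  simp only [Matrix.det_apply']
  exact ContDiffOn.sum fun σ _ => contDiffOn_const.mul (contDiffOn_prod fun i _ => hA _ _)

lemma smoothField_invMetric {A : MatField} (hA : SmoothField U A)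
    (hdet : ∀ x ∈ U, IsUnit (A x).det) : SmoothField U (invMetric A) := by
  intro a b
  simp only [invMetric, Matrix.inv_def, Ring.inverse_eq_inv', Matrix.smul_apply, smul_eq_mul,
    Matrix.adjugate_apply]
  refine ((contDiffOn_det hA).inv fun x hx => (hdet x hx).ne_zero).mul
    (contDiffOn_det (A := fun x => (A x).updateRow b (Pi.single a 1)) fun i j => ?_)
  by_cases hi : i = b
  · subst hi
    simpa only [Matrix.updateRow_self] using contDiffOn_const
  · simpa only [Matrix.updateRow_ne hi] using hA i j

lemma IsLorentzMetric.smoothField_inv {g : MatField} (hg : IsLorentzMetric U g) :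
    SmoothField U (invMetric g) :=
  smoothField_invMetric hg.1 fun x hx => (hg.2 x hx).isUnit_det

lemma contDiffOn_christoffel (hU : IsOpen U) {g : MatField} (hg : IsLorentzMetric U g)
    (d a b : Fin 4) : ContDiffOn ℝ ∞ (christoffel g d a b) U :=
  contDiffOn_const.mul (ContDiffOn.sum fun c _ => (hg.smoothField_inv d c).mul
    (((contDiffOn_pd hU (hg.1 _ _) _).add (contDiffOn_pd hU (hg.1 _ _) _)).sub
      (contDiffOn_pd hU (hg.1 _ _) _)))

lemma contDiffOn_nablaPow (hU : IsOpen U) {g : MatField} (hg : IsLorentzMetric U g) {u : Pt → ℝ}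
    (hu : ContDiffOn ℝ ∞ u U) (j : ℕ) (I : Fin j → Fin 4) :
    ContDiffOn ℝ ∞ (nablaPow g u j I) U := by
  induction j with
  | zero => exact hu
  | succ j ih =>
    exact (contDiffOn_pd hU (ih _) _).sub (ContDiffOn.sum fun s _ => ContDiffOn.sum fun d _ =>
      (contDiffOn_christoffel hU hg _ _ _).mul (ih _))

lemma contDiffOn_pdPow (hU : IsOpen U) {u : Pt → ℝ} (hu : ContDiffOn ℝ ∞ u U) (j : ℕ)
    (I : Fin j → Fin 4) : ContDiffOn ℝ ∞ (pdPow u j I) U := by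
  induction j with
  | zero => exact hu
  | succ j ih => exact contDiffOn_pd hU (ih _) _

end Derivative

/-! ### Calculus of orders in `ε` -/

/-- A family of smooth functions on `U` that is `O(ε^{-n})` on `K`. -/
def HasBound (U K : Set Pt) (n : ℕ) (f : ℝ → Pt → ℝ) : Prop :=
  (∀ᶠ ε in 𝓝[>] (0 : ℝ), ContDiffOn ℝ ∞ (f ε) U) ∧
    ∃ C : ℝ, ∀ᶠ ε in 𝓝[>] (0 : ℝ), ∀ x ∈ K, |f ε x| ≤ C / ε ^ n

/-- The partial derivatives of order `i ≤ d` of a family of smooth functions on `U` are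
`O(ε^{-(n+i)})` on `K`. -/
def HasOrderUpTo (U K : Set Pt) : ℕ → ℕ → (ℝ → Pt → ℝ) → Prop
  | 0, n, f => HasBound U K n f
  | d + 1, n, f => HasBound U K n f ∧ ∀ c, HasOrderUpTo U K d (n + 1) (fun ε => pd c (f ε))

/-- All partial derivatives of order `i` are `O(ε^{-(n+i)})` on `K`. -/
def HasOrder (U K : Set Pt) (n : ℕ) (f : ℝ → Pt → ℝ) : Prop :=
  ∀ d, HasOrderUpTo U K d n f

section Order

variable {U K : Set Pt}

lemma HasOrderUpTo.of_succ {d n : ℕ} {f : ℝ → Pt → ℝ} (h : HasOrderUpTo U K (d + 1) n f) :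
    HasOrderUpTo U K d n f := by
  induction d generalizing n f with
  | zero => exact h.1
  | succ d ih => exact ⟨h.1, fun c => ih (h.2 c)⟩

lemma HasBound.congr (hK : K ⊆ U) {n : ℕ} {f h : ℝ → Pt → ℝ}
    (hf : HasBound U K n f) (hfh : ∀ᶠ ε in 𝓝[>] (0 : ℝ), ∀ x ∈ U, h ε x = f ε x) :
    HasBound U K n h := by
  obtain ⟨h1, C, hC⟩ := hf
  refine ⟨?_, C, ?_⟩
  · filter_upwards [h1, hfh] with ε h1 h2 using h1.congr h2
  · filter_upwards [hC, hfh] with ε h1 h2 x hx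
    rw [h2 x (hK hx)]
    exact h1 x hx

/-- Agreement is required on the open set `U` and not only on `K`, so that derivatives agree as
well. -/
lemma HasOrderUpTo.congr (hU : IsOpen U) (hK : K ⊆ U) {d n : ℕ} {f h : ℝ → Pt → ℝ}
    (hf : HasOrderUpTo U K d n f) (hfh : ∀ᶠ ε in 𝓝[>] (0 : ℝ), ∀ x ∈ U, h ε x = f ε x) :
    HasOrderUpTo U K d n h := by
  induction d generalizing n f h with
  | zero => exact HasBound.congr hK hf hfh
  | succ d ih =>
    refine ⟨hf.1.congr hK hfh, fun c => ih (hf.2 c) ?_⟩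
    filter_upwards [hfh] with ε h x hx using pd_congr hU h c hx

lemma HasBound.add {n : ℕ} {f h : ℝ → Pt → ℝ} (hf : HasBound U K n f) (hh : HasBound U K n h) :
    HasBound U K n (fun ε x => f ε x + h ε x) := by
  obtain ⟨h1, C, hC⟩ := hf
  obtain ⟨h2, C', hC'⟩ := hh
  refine ⟨?_, C + C', ?_⟩
  · filter_upwards [h1, h2] with ε h1 h2 using h1.add h2
  · filter_upwards [hC, hC'] with ε h1 h2 x hx
    rw [add_div]
    exact (abs_add_le _ _).trans (add_le_add (h1 x hx) (h2 x hx))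

lemma HasBound.mul {n m : ℕ} {f h : ℝ → Pt → ℝ} (hf : HasBound U K n f)
    (hh : HasBound U K m h) : HasBound U K (n + m) (fun ε x => f ε x * h ε x) := by
  obtain ⟨h1, C, hC⟩ := hf
  obtain ⟨h2, C', hC'⟩ := hh
  refine ⟨?_, C * C', ?_⟩
  · filter_upwards [h1, h2] with ε h1 h2 using h1.mul h2
  · filter_upwards [hC, hC'] with ε h1 h2 x hx
    rw [pow_add, mul_div_mul_comm, abs_mul]
    exact mul_le_mul (h1 x hx) (h2 x hx) (abs_nonneg _) ((abs_nonneg _).trans (h1 x hx))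

lemma HasOrderUpTo.add (hU : IsOpen U) (hK : K ⊆ U) {d n : ℕ} {f h : ℝ → Pt → ℝ}
    (hf : HasOrderUpTo U K d n f) (hh : HasOrderUpTo U K d n h) :
    HasOrderUpTo U K d n (fun ε x => f ε x + h ε x) := by
  induction d generalizing n f h with
  | zero => exact HasBound.add hf hh
  | succ d ih =>
    refine ⟨hf.1.add hh.1, fun c => (ih (hf.2 c) (hh.2 c)).congr hU hK ?_⟩
    filter_upwards [hf.1.1, hh.1.1] with ε h1 h2 x hx using pd_add hU h1 h2 c hx

/-- Leibniz: one factor loses a derivative and gains an order, while the other keeps its order and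
is only needed up to `d` derivatives (`of_succ`). -/
lemma HasOrderUpTo.mul (hU : IsOpen U) (hK : K ⊆ U) {d n m : ℕ} {f h : ℝ → Pt → ℝ}
    (hf : HasOrderUpTo U K d n f) (hh : HasOrderUpTo U K d m h) :
    HasOrderUpTo U K d (n + m) (fun ε x => f ε x * h ε x) := by
  induction d generalizing n m f h with
  | zero => exact HasBound.mul hf hh
  | succ d ih =>
    refine ⟨hf.1.mul hh.1, fun c => ?_⟩
    have h1 := ih (hf.2 c) hh.of_succ
    have h2 := ih hf.of_succ (hh.2 c)
    rw [show n + 1 + m = n + m + 1 by ring] at h1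
    refine (h1.add hU hK h2).congr hU hK ?_
    filter_upwards [hf.1.1, hh.1.1] with ε h1 h2 x hx using pd_mul hU h1 h2 c hx

lemma HasOrder.contDiffOn {n : ℕ} {f : ℝ → Pt → ℝ} (h : HasOrder U K n f) :
    ∀ᶠ ε in 𝓝[>] (0 : ℝ), ContDiffOn ℝ ∞ (f ε) U := (h 0).1

lemma HasOrder.bound {n : ℕ} {f : ℝ → Pt → ℝ} (h : HasOrder U K n f) :
    ∃ C : ℝ, ∀ᶠ ε in 𝓝[>] (0 : ℝ), ∀ x ∈ K, |f ε x| ≤ C / ε ^ n := (h 0).2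

lemma HasOrder.pd {n : ℕ} {f : ℝ → Pt → ℝ} (h : HasOrder U K n f) (c : Fin 4) :
    HasOrder U K (n + 1) (fun ε => pd c (f ε)) := fun d => (h (d + 1)).2 c

lemma HasOrder.add (hU : IsOpen U) (hK : K ⊆ U) {n : ℕ} {f h : ℝ → Pt → ℝ}
    (hf : HasOrder U K n f) (hh : HasOrder U K n h) :
    HasOrder U K n (fun ε x => f ε x + h ε x) := fun d => (hf d).add hU hK (hh d)

lemma HasOrder.mul (hU : IsOpen U) (hK : K ⊆ U) {n m : ℕ} {f h : ℝ → Pt → ℝ}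
    (hf : HasOrder U K n f) (hh : HasOrder U K m h) :
    HasOrder U K (n + m) (fun ε x => f ε x * h ε x) := fun d => (hf d).mul hU hK (hh d)

/-- Every order `n` is needed, because the derivative of a constant must count as order `1`. -/
lemma hasOrder_zero (n : ℕ) : HasOrder U K n (fun _ _ => 0) := by
  intro d
  have h0 : ∀ n, HasBound U K n (fun _ _ => 0) := fun n =>
    ⟨Eventually.of_forall fun _ => contDiffOn_const, 0, Eventually.of_forall fun ε x _ => by simp⟩
  induction d generalizing n with
  | zero => exact h0 n
  | succ d ih =>
    refine ⟨h0 n, fun c => ?_⟩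
    have : (fun (_ : ℝ) => EnergySobolev.pd c (fun _ : Pt => (0 : ℝ))) = fun _ _ => 0 := by
      funext ε x
      exact pd_const c 0 x
    rw [this]
    exact ih _

lemma hasOrder_const (r : ℝ) : HasOrder U K 0 (fun _ _ => r) := by
  intro d
  have h0 : HasBound U K 0 (fun _ _ => r) :=
    ⟨Eventually.of_forall fun _ => contDiffOn_const, |r|,
      Eventually.of_forall fun ε x _ => by simp⟩
  cases d with
  | zero => exact h0
  | succ d =>
    refine ⟨h0, fun c => ?_⟩
    have : (fun (_ : ℝ) => EnergySobolev.pd c (fun _ : Pt => r)) = fun _ _ => 0 := by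
      funext ε x
      exact pd_const c r x
    rw [this]
    exact hasOrder_zero _ _

lemma HasOrder.const_mul (hU : IsOpen U) (hK : K ⊆ U) {n : ℕ} {f : ℝ → Pt → ℝ}
    (hf : HasOrder U K n f) (r : ℝ) : HasOrder U K n (fun ε x => r * f ε x) := by
  simpa only [zero_add] using (hasOrder_const r).mul hU hK hf

lemma HasOrder.sum (hU : IsOpen U) (hK : K ⊆ U) {ι : Type*} (s : Finset ι) {n : ℕ}
    {f : ι → ℝ → Pt → ℝ} (hf : ∀ i ∈ s, HasOrder U K n (f i)) :
    HasOrder U K n (fun ε x => ∑ i ∈ s, f i ε x) := by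
  classical
  induction s using Finset.induction_on with
  | empty => simpa using hasOrder_zero n
  | insert i s hi ih =>
    simp only [Finset.sum_insert hi]
    exact (hf i (Finset.mem_insert_self i s)).add hU hK
      (ih fun j hj => hf j (Finset.mem_insert_of_mem hj))

end Order

/-! ### Condition (A) in coordinates -/

section Metrics

variable {U K : Set Pt}

/-- Iterated coordinate derivatives along a list of indices. -/
noncomputable def pdList (L : List (Fin 4)) (f : Pt → ℝ) : Pt → ℝ := L.foldr pd f

/-- Coordinate fields have constant components, so only the transport term of the Lie derivative
survives. -/
lemma foldr_lieDown_coord (T : MatField) (L : List (Fin 4)) :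
    (L.map fun c => fun _ : Pt => (Pi.single c 1 : Pt)).foldr lieDown T =
      fun x => Matrix.of fun a b => pdList L (fun y => T y a b) x := by
  induction L with
  | nil => rfl
  | cons c L ih =>
    rw [List.map_cons, List.foldr_cons, ih]
    funext x
    ext a b
    simp only [lieDown, Matrix.of_apply, pd_const, mul_zero, add_zero, pdList, List.foldr_cons]
    rw [Finset.sum_eq_single c (fun d _ hd => by simp [Pi.single_eq_of_ne hd]) (by simp)]
    simp

lemma foldr_lieUp_coord (T : MatField) (L : List (Fin 4)) :
    (L.map fun c => fun _ : Pt => (Pi.single c 1 : Pt)).foldr lieUp T =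
      fun x => Matrix.of fun a b => pdList L (fun y => T y a b) x := by
  induction L with
  | nil => rfl
  | cons c L ih =>
    rw [List.map_cons, List.foldr_cons, ih]
    funext x
    ext a b
    simp only [lieUp, Matrix.of_apply, pd_const, mul_zero, sub_zero, pdList, List.foldr_cons]
    rw [Finset.sum_eq_single c (fun d _ hd => by simp [Pi.single_eq_of_ne hd]) (by simp)]
    simp

lemma tensorForm_two (M T : Matrix (Fin 4) (Fin 4) ℝ) :
    tensorForm (j := 2) M (fun I => T (I 0) (I 1)) =
      ∑ a, ∑ b, ∑ c, ∑ d, M a c * M b d * T a b * T c d := by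
  have h : ∀ f : (Fin 2 → Fin 4) → ℝ, ∑ I, f I = ∑ a, ∑ b, f ![a, b] := fun f => by
    rw [← (finTwoArrowEquiv (Fin 4)).symm.sum_comp, Fintype.sum_prod_type]
    rfl
  simp only [tensorForm, h, Fin.prod_univ_two, Matrix.cons_val_zero, Matrix.cons_val_one]

lemma sq_le_of_posSemidef {A A' : Matrix (Fin 4) (Fin 4) ℝ} (hA : A.PosSemidef) (h : A * A' = 1)
    {c : ℝ} (hc : ∀ a b, |A' a b| ≤ c) (T : Matrix (Fin 4) (Fin 4) ℝ) (a b : Fin 4) :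
    |T a b| ≤ 16 * c * Real.sqrt (∑ a, ∑ b, ∑ c, ∑ d, A a c * A b d * T a b * T c d) := by
  have hc0 : 0 ≤ c := (abs_nonneg _).trans (hc 0 0)
  have h1 := sum_sq_le_tensorForm hA h hc (j := 2) (fun I => T (I 0) (I 1))
  have h2 := Finset.single_le_sum (f := fun I : Fin 2 → Fin 4 => T (I 0) (I 1) ^ 2)
    (fun _ _ => sq_nonneg _) (Finset.mem_univ ![a, b])
  rw [tensorForm_two] at h1
  have h3 := Real.sqrt_le_sqrt (h2.trans h1)
  simp only [Matrix.cons_val_zero, Matrix.cons_val_one] at h3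
  rwa [Real.sqrt_sq_eq_abs, Real.sqrt_mul (by positivity), Real.sqrt_sq (by positivity)] at h3

lemma exists_entry_bound {A : MatField} (hA : SmoothField U A) (hK : IsCompact K) (hKU : K ⊆ U) :
    ∃ c, ∀ x ∈ K, ∀ a b, |A x a b| ≤ c := by
  have h : ∀ p : Fin 4 × Fin 4, ∃ c, ∀ x ∈ K, |A x p.1 p.2| ≤ c := fun p => by
    obtain ⟨c, hc⟩ := hK.exists_bound_of_continuousOn ((hA p.1 p.2).continuousOn.mono hKU)
    exact ⟨c, hc⟩
  choose c hc using h
  obtain ⟨C, hC⟩ := Finite.bddAbove_range c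
  exact ⟨C, fun x hx a b => (hc (a, b) x hx).trans (hC ⟨(a, b), rfl⟩)⟩

/-- This norm is built from `m⁻¹`, whose inverse `m` has bounded entries on `K`. The constant serves
all `T`, hence all `ε`. -/
lemma exists_normDown_bound {m : MatField} (hm : IsRiemannMetric U m) (hK : IsCompact K)
    (hKU : K ⊆ U) : ∃ c, 0 ≤ c ∧ ∀ x ∈ K, ∀ (T : MatField) (a b : Fin 4),
      |T x a b| ≤ c * normDown m T x := by
  obtain ⟨c, hc⟩ := exists_entry_bound hm.1 hK hKU
  refine ⟨|16 * c|, abs_nonneg _, fun x hx T a b => ?_⟩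
  have hdet : IsUnit (m x).det := (m x).isUnit_iff_isUnit_det.1 (hm.2 x (hKU hx)).isUnit
  refine (sq_le_of_posSemidef (hm.2 x (hKU hx)).inv.posSemidef (Matrix.nonsing_inv_mul _ hdet)
    (hc x hx) (T x) a b).trans ?_
  exact mul_le_mul_of_nonneg_right (le_abs_self _) (Real.sqrt_nonneg _)

lemma exists_normUp_bound {m : MatField} (hm : IsRiemannMetric U m) (hK : IsCompact K)
    (hKU : K ⊆ U) : ∃ c, 0 ≤ c ∧ ∀ x ∈ K, ∀ (T : MatField) (a b : Fin 4),
      |T x a b| ≤ c * normUp m T x := by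
  have hdet : ∀ x ∈ U, IsUnit (m x).det := fun x hx =>
    (m x).isUnit_iff_isUnit_det.1 (hm.2 x hx).isUnit
  obtain ⟨c, hc⟩ := exists_entry_bound (smoothField_invMetric hm.1 hdet) hK hKU
  refine ⟨|16 * c|, abs_nonneg _, fun x hx T a b => ?_⟩
  refine (sq_le_of_posSemidef (hm.2 x (hKU hx)).posSemidef
    (Matrix.mul_nonsing_inv _ (hdet x (hKU hx))) (hc x hx) (T x) a b).trans ?_
  exact mul_le_mul_of_nonneg_right (le_abs_self _) (Real.sqrt_nonneg _)

lemma contDiffOn_pdList (hU : IsOpen U) {f : Pt → ℝ} (hf : ContDiffOn ℝ ∞ f U)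
    (L : List (Fin 4)) : ContDiffOn ℝ ∞ (pdList L f) U := by
  induction L with
  | nil => exact hf
  | cons c L ih => exact contDiffOn_pd hU ih c

lemma hasOrder_of_pdList_bound (hU : IsOpen U) {f : ℝ → Pt → ℝ}
    (hf : ∀ᶠ ε in 𝓝[>] (0 : ℝ), ContDiffOn ℝ ∞ (f ε) U)
    (hb : ∀ L : List (Fin 4), ∃ C : ℝ, ∀ᶠ ε in 𝓝[>] (0 : ℝ), ∀ x ∈ K,
      |pdList L (f ε) x| ≤ C / ε ^ L.length) : HasOrder U K 0 f := by
  have key : ∀ (d : ℕ) (L : List (Fin 4)),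
      HasOrderUpTo U K d L.length (fun ε => pdList L (f ε)) := fun d => by
    have h0 : ∀ L : List (Fin 4), HasBound U K L.length (fun ε => pdList L (f ε)) :=
      fun L => ⟨by filter_upwards [hf] with ε h using contDiffOn_pdList hU h L, hb L⟩
    induction d with
    | zero => exact h0
    | succ d ih => exact fun L => ⟨h0 L, fun c => ih (c :: L)⟩
  exact fun d => key d []

lemma eventually_isLorentzMetric {g : ℝ → MatField}
    (hg : ∀ ε ∈ Set.Ioc (0 : ℝ) 1, IsLorentzMetric U (g ε)) :
    ∀ᶠ ε in 𝓝[>] (0 : ℝ), IsLorentzMetric U (g ε) := by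
  filter_upwards [Ioc_mem_nhdsGT (zero_lt_one' ℝ)] with ε hε using hg ε hε

variable {m : MatField} {g : ℝ → MatField}

lemma hasOrder_metric (hU : IsOpen U) (hm : IsRiemannMetric U m)
    (hg : ∀ᶠ ε in 𝓝[>] (0 : ℝ), IsLorentzMetric U (g ε)) (hA : ConditionA U m g)
    (hK : IsCompact K) (hKU : K ⊆ U) (a b : Fin 4) :
    HasOrder U K 0 (fun ε x => g ε x a b) := by
  refine hasOrder_of_pdList_bound hU (hg.mono fun ε h => h.1 a b) fun L => ?_
  obtain ⟨c, hc0, hc⟩ := exists_normDown_bound hm hK hKU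
  obtain ⟨⟨C, hC⟩, -⟩ := hA K hK hKU (L.map fun c => fun _ : Pt => (Pi.single c 1 : Pt))
    (by simp only [List.mem_map]; rintro η ⟨c, -, rfl⟩; exact contDiffOn_const)
  refine ⟨c * C, ?_⟩
  filter_upwards [hC] with ε hε x hx
  rw [foldr_lieDown_coord, List.length_map] at hε
  rw [mul_div_assoc]
  exact (hc x hx _ a b).trans (mul_le_mul_of_nonneg_left (hε x hx) hc0)

lemma hasOrder_invMetric (hU : IsOpen U) (hm : IsRiemannMetric U m)
    (hg : ∀ᶠ ε in 𝓝[>] (0 : ℝ), IsLorentzMetric U (g ε)) (hA : ConditionA U m g)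
    (hK : IsCompact K) (hKU : K ⊆ U) (a b : Fin 4) :
    HasOrder U K 0 (fun ε x => invMetric (g ε) x a b) := by
  refine hasOrder_of_pdList_bound hU (hg.mono fun ε h => h.smoothField_inv a b) fun L => ?_
  obtain ⟨c, hc0, hc⟩ := exists_normUp_bound hm hK hKU
  obtain ⟨-, C, hC⟩ := hA K hK hKU (L.map fun c => fun _ : Pt => (Pi.single c 1 : Pt))
    (by simp only [List.mem_map]; rintro η ⟨c, -, rfl⟩; exact contDiffOn_const)
  refine ⟨c * C, ?_⟩
  filter_upwards [hC] with ε hε x hx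
  rw [foldr_lieUp_coord, List.length_map] at hε
  rw [mul_div_assoc]
  exact (hc x hx _ a b).trans (mul_le_mul_of_nonneg_left (hε x hx) hc0)

/-- Each term of `Γ` has exactly one derivative of `g`; all other factors have order `0`. -/
lemma hasOrder_christoffel (hU : IsOpen U) (hKU : K ⊆ U)
    (hd : ∀ a b, HasOrder U K 0 (fun ε x => g ε x a b))
    (hu : ∀ a b, HasOrder U K 0 (fun ε x => invMetric (g ε) x a b)) (d a b : Fin 4) :
    HasOrder U K 1 (fun ε => christoffel (g ε) d a b) := by
  have h : HasOrder U K 1 (fun ε x => (1 / 2 : ℝ) * ∑ c, invMetric (g ε) x d c *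
      ((pd a (fun y => g ε y b c) x + pd b (fun y => g ε y a c) x) +
        (-1) * pd c (fun y => g ε y a b) x)) := by
    refine HasOrder.const_mul hU hKU (HasOrder.sum hU hKU _ fun c _ => ?_) _
    simpa only [zero_add] using (hu d c).mul hU hKU
      ((((hd b c).pd a).add hU hKU ((hd a c).pd b)).add hU hKU
        (((hd a b).pd c).const_mul hU hKU (-1)))
  intro k
  refine (h k).congr hU hKU (Eventually.of_forall fun ε x _ => ?_)
  simp only [christoffel, neg_one_mul, sub_eq_add_neg]

end Metrics

/-! ### Weighted combinations of differential operators -/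

/-- Families of operators `u ↦ ∑_{1 ≤ i ≤ n} ∑_J a_{iJ} D_{iJ} u` with coefficients `a_{iJ}` of
order `n - i`, for given operators `D_{iJ}`. -/
inductive Comb (U K : Set Pt) (D : (i : ℕ) → (Fin i → Fin 4) → ℝ → (Pt → ℝ) → Pt → ℝ) :
    ℕ → (ℝ → (Pt → ℝ) → Pt → ℝ) → Prop
  | zero (n : ℕ) : Comb U K D n (fun _ _ _ => 0)
  | smul {i r : ℕ} (hi : 1 ≤ i) (J : Fin i → Fin 4) {a : ℝ → Pt → ℝ} (ha : HasOrder U K r a) :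
      Comb U K D (i + r) (fun ε u x => a ε x * D i J ε u x)
  | add {n : ℕ} {F G : ℝ → (Pt → ℝ) → Pt → ℝ} (hF : Comb U K D n F) (hG : Comb U K D n G) :
      Comb U K D n (fun ε u x => F ε u x + G ε u x)
  | congr {n : ℕ} {F G : ℝ → (Pt → ℝ) → Pt → ℝ} (hF : Comb U K D n F)
      (h : ∀ᶠ ε in 𝓝[>] (0 : ℝ), ∀ u, ContDiffOn ℝ ∞ u U → ∀ x ∈ U, G ε u x = F ε u x) :
      Comb U K D n G

section Comb

variable {U K : Set Pt} {D : (i : ℕ) → (Fin i → Fin 4) → ℝ → (Pt → ℝ) → Pt → ℝ}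

lemma Comb.sum {ι : Type*} (s : Finset ι) {n : ℕ} {F : ι → ℝ → (Pt → ℝ) → Pt → ℝ}
    (hF : ∀ i ∈ s, Comb U K D n (F i)) : Comb U K D n (fun ε u x => ∑ i ∈ s, F i ε u x) := by
  classical
  induction s using Finset.induction_on with
  | empty => simpa using Comb.zero n
  | insert i s hi ih =>
    simp only [Finset.sum_insert hi]
    exact (hF i (Finset.mem_insert_self i s)).add
      (ih fun j hj => hF j (Finset.mem_insert_of_mem hj))

lemma Comb.coeff_mul (hU : IsOpen U) (hK : K ⊆ U) {n r : ℕ} {F : ℝ → (Pt → ℝ) → Pt → ℝ}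
    (hF : Comb U K D n F) {a : ℝ → Pt → ℝ} (ha : HasOrder U K r a) :
    Comb U K D (n + r) (fun ε u x => a ε x * F ε u x) := by
  induction hF with
  | zero n => simpa using Comb.zero (n + r)
  | @smul i q hi J b hb =>
    have := Comb.smul (D := D) hi J (hb.mul hU hK ha)
    rw [← add_assoc] at this
    exact this.congr (Eventually.of_forall fun ε u _ x _ => by ring)
  | add _ _ ih1 ih2 =>
    exact (ih1.add ih2).congr (Eventually.of_forall fun ε u _ x _ => by ring)
  | congr _ h ih =>
    refine ih.congr ?_
    filter_upwards [h] with ε h u hu x hx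
    rw [h u hu x hx]

lemma Comb.basis {i : ℕ} (hi : 1 ≤ i) (J : Fin i → Fin 4) : Comb U K D i (D i J) := by
  have := Comb.smul (D := D) hi J (hasOrder_const (U := U) (K := K) 1)
  exact this.congr (Eventually.of_forall fun ε u _ x _ => by ring)

/-- The operators `D_{iJ}` preserve smoothness on `U`, for small `ε`. -/
def PreservesSmooth (U : Set Pt)
    (D : (i : ℕ) → (Fin i → Fin 4) → ℝ → (Pt → ℝ) → Pt → ℝ) : Prop :=
  ∀ᶠ ε in 𝓝[>] (0 : ℝ), ∀ u, ContDiffOn ℝ ∞ u U → ∀ i J, ContDiffOn ℝ ∞ (D i J ε u) U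

lemma Comb.contDiffOn (hD : PreservesSmooth U D) {n : ℕ} {F : ℝ → (Pt → ℝ) → Pt → ℝ}
    (hF : Comb U K D n F) :
    ∀ᶠ ε in 𝓝[>] (0 : ℝ), ∀ u, ContDiffOn ℝ ∞ u U → ContDiffOn ℝ ∞ (F ε u) U := by
  induction hF with
  | zero n => exact Eventually.of_forall fun _ _ _ => contDiffOn_const
  | smul hi J ha =>
    filter_upwards [hD, ha.contDiffOn] with ε h1 h2 u hu using h2.mul (h1 u hu _ _)
  | add _ _ ih1 ih2 => filter_upwards [ih1, ih2] with ε h1 h2 u hu using (h1 u hu).add (h2 u hu)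
  | congr _ h ih => filter_upwards [h, ih] with ε h1 h2 u hu using (h2 u hu).congr (h1 u hu)

/-- By Leibniz the derivative falls either on a coefficient, raising its order, or on `D_{iJ}`,
where `hpd` applies; both raise the total weight by one. -/
lemma Comb.pd (hU : IsOpen U) (hK : K ⊆ U) (hD : PreservesSmooth U D)
    (hpd : ∀ i, 1 ≤ i → ∀ (J : Fin i → Fin 4) (c : Fin 4),
      Comb U K D (i + 1) (fun ε u => pd c (D i J ε u)))
    {n : ℕ} {F : ℝ → (Pt → ℝ) → Pt → ℝ} (hF : Comb U K D n F) (c : Fin 4) :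
    Comb U K D (n + 1) (fun ε u => pd c (F ε u)) := by
  induction hF with
  | zero n =>
    exact (Comb.zero (n + 1)).congr (Eventually.of_forall fun ε u _ x _ => pd_const c 0 x)
  | @smul i r hi J a ha =>
    have h1 := Comb.smul (D := D) hi J (ha.pd c)
    have h2 := (hpd i hi J c).coeff_mul hU hK ha
    rw [← add_assoc] at h1
    rw [add_right_comm] at h2
    refine (h1.add h2).congr ?_
    filter_upwards [hD, ha.contDiffOn] with ε h3 h4 u hu x hx using
      pd_mul hU h4 (h3 u hu i J) c hx
  | add hF hG ih1 ih2 =>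
    refine (ih1.add ih2).congr ?_
    filter_upwards [hF.contDiffOn hD, hG.contDiffOn hD] with ε h1 h2 u hu x hx using
      pd_add hU (h1 u hu) (h2 u hu) c hx
  | congr _ h ih =>
    refine ih.congr ?_
    filter_upwards [h] with ε h u hu x hx using pd_congr hU (h u hu) c hx

/-- `C` comes from the coefficients alone, so both it and the range of `ε` are independent of `u`.
-/
lemma Comb.exists_sq_le (hK : K ⊆ U) {n : ℕ} {F : ℝ → (Pt → ℝ) → Pt → ℝ}
    (hF : Comb U K D n F) : ∃ C : ℝ, 0 ≤ C ∧ ∀ᶠ ε in 𝓝[>] (0 : ℝ),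
      ∀ u, ContDiffOn ℝ ∞ u U → ∀ x ∈ K, F ε u x ^ 2 ≤
        C * ∑ i ∈ Finset.Icc 1 n, 1 / ε ^ (2 * (n - i)) * ∑ J, D i J ε u x ^ 2 := by
  induction hF with
  | zero n => exact ⟨0, le_rfl, Eventually.of_forall fun ε u _ x _ => by simp⟩
  | @smul i r hi J a ha =>
    obtain ⟨C, hC⟩ := ha.bound
    refine ⟨C ^ 2, sq_nonneg C, ?_⟩
    filter_upwards [hC, self_mem_nhdsWithin] with ε h (hε : 0 < ε) u _ x hx
    have h1 : 1 / ε ^ (2 * r) * D i J ε u x ^ 2 ≤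
        ∑ l ∈ Finset.Icc 1 (i + r), 1 / ε ^ (2 * (i + r - l)) * ∑ J, D l J ε u x ^ 2 := by
      refine le_trans ?_ (Finset.single_le_sum (fun l _ => ?_)
        (Finset.mem_Icc.2 ⟨hi, Nat.le_add_right i r⟩))
      · rw [Nat.add_sub_cancel_left]
        refine mul_le_mul_of_nonneg_left ?_ (by positivity)
        exact Finset.single_le_sum (f := fun J => D i J ε u x ^ 2) (fun _ _ => sq_nonneg _)
          (Finset.mem_univ J)
      · positivity
    refine le_trans ?_ (mul_le_mul_of_nonneg_left h1 (sq_nonneg C))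
    have h2 : a ε x ^ 2 ≤ (C / ε ^ r) ^ 2 := by
      rw [← sq_abs]
      exact pow_le_pow_left₀ (abs_nonneg _) (h x hx) 2
    calc (a ε x * D i J ε u x) ^ 2 = a ε x ^ 2 * D i J ε u x ^ 2 := by ring
      _ ≤ (C / ε ^ r) ^ 2 * D i J ε u x ^ 2 := mul_le_mul_of_nonneg_right h2 (sq_nonneg _)
      _ = C ^ 2 * (1 / ε ^ (2 * r) * D i J ε u x ^ 2) := by
        rw [mul_comm 2 r, pow_mul]; ring
  | add _ _ ih1 ih2 =>
    obtain ⟨C, hC0, hC⟩ := ih1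
    obtain ⟨C', hC0', hC'⟩ := ih2
    refine ⟨2 * (C + C'), by positivity, ?_⟩
    filter_upwards [hC, hC'] with ε h1 h2 u hu x hx
    refine add_sq_le.trans ?_
    rw [mul_assoc, add_mul]
    exact mul_le_mul_of_nonneg_left (add_le_add (h1 u hu x hx) (h2 u hu x hx)) zero_le_two
  | congr _ h ih =>
    obtain ⟨C, hC0, hC⟩ := ih
    refine ⟨C, hC0, ?_⟩
    filter_upwards [hC, h] with ε h1 h2 u hu x hx
    rw [h2 u hu x (hK hx)]
    exact h1 u hu x hx

end Comb

/-! ### Passing between `∇` and `∂` -/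

section Transition

variable {U K : Set Pt} {g : ℝ → MatField}

/-- The operators `∂_J`. -/
noncomputable def partialOps (i : ℕ) (J : Fin i → Fin 4) (_ : ℝ) (u : Pt → ℝ) : Pt → ℝ :=
  pdPow u i J

/-- The operators `∇_J` of the metrics `g_ε`. -/
noncomputable def nablaOps (g : ℝ → MatField) (i : ℕ) (J : Fin i → Fin 4) (ε : ℝ) (u : Pt → ℝ) :
    Pt → ℝ := nablaPow (g ε) u i J

lemma preservesSmooth_partialOps (hU : IsOpen U) : PreservesSmooth U partialOps :=
  Eventually.of_forall fun _ _ hu i J => contDiffOn_pdPow hU hu i J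

lemma preservesSmooth_nablaOps (hU : IsOpen U)
    (hg : ∀ᶠ ε in 𝓝[>] (0 : ℝ), IsLorentzMetric U (g ε)) : PreservesSmooth U (nablaOps g) := by
  filter_upwards [hg] with ε hg u hu i J using contDiffOn_nablaPow hU hg hu i J

lemma comb_pd_partialOps (i : ℕ) (J : Fin i → Fin 4) (c : Fin 4) :
    Comb U K partialOps (i + 1) (fun ε u => pd c (partialOps i J ε u)) :=
  (Comb.basis (Nat.le_add_left 1 i) (Fin.cons c J)).congr
    (Eventually.of_forall fun ε u _ x _ => by simp [partialOps, pdPow])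

/-- Solves the definition of `∇_c ∇_J u` for `∂_c ∇_J u`; the correction terms carry one `Γ`, of
order `1`. -/
lemma comb_pd_nablaOps (hU : IsOpen U) (hK : K ⊆ U)
    (hΓ : ∀ d a b, HasOrder U K 1 (fun ε => christoffel (g ε) d a b)) (i : ℕ) (hi : 1 ≤ i)
    (J : Fin i → Fin 4) (c : Fin 4) :
    Comb U K (nablaOps g) (i + 1) (fun ε u => pd c (nablaOps g i J ε u)) := by
  have h : Comb U K (nablaOps g) (i + 1) (fun ε u x => nablaOps g (i + 1) (Fin.cons c J) ε u x +
      ∑ s, ∑ d, christoffel (g ε) d c (J s) x * nablaOps g i (Function.update J s d) ε u x) :=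
    (Comb.basis (Nat.le_add_left 1 i) (Fin.cons c J)).add (Comb.sum _ fun s _ => Comb.sum _
      fun d _ => (Comb.basis hi _).coeff_mul hU hK (hΓ d c (J s)))
  refine h.congr (Eventually.of_forall fun ε u _ x _ => ?_)
  simp [nablaOps, nablaPow, covD]

lemma comb_nablaOps (hU : IsOpen U) (hK : K ⊆ U)
    (hΓ : ∀ d a b, HasOrder U K 1 (fun ε => christoffel (g ε) d a b)) {j : ℕ} (hj : 1 ≤ j)
    (I : Fin j → Fin 4) : Comb U K partialOps j (nablaOps g j I) := by
  induction j, hj using Nat.le_induction with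
  | base =>
    -- On functions the Christoffel sum is empty; hence no term in `u` itself ever arises.
    refine (Comb.basis le_rfl I).congr (Eventually.of_forall fun ε u _ x _ => ?_)
    simp [nablaOps, nablaPow, covD, partialOps, pdPow]
  | succ j hj ih =>
    have h1 := (ih (Fin.tail I)).pd hU hK (preservesSmooth_partialOps hU)
      (fun i _ => comb_pd_partialOps i) (I 0)
    have h2 : Comb U K partialOps (j + 1) (fun ε u x => ∑ s, ∑ d,
        (-1 * christoffel (g ε) d (I 0) (Fin.tail I s) x) *
          nablaOps g j (Function.update (Fin.tail I) s d) ε u x) :=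
      Comb.sum _ fun s _ => Comb.sum _ fun d _ =>
        (ih _).coeff_mul hU hK ((hΓ d (I 0) (Fin.tail I s)).const_mul hU hK (-1))
    refine (h1.add h2).congr (Eventually.of_forall fun ε u _ x _ => ?_)
    simp [nablaOps, nablaPow, covD, sub_eq_add_neg]

lemma comb_partialOps (hU : IsOpen U) (hK : K ⊆ U)
    (hg : ∀ᶠ ε in 𝓝[>] (0 : ℝ), IsLorentzMetric U (g ε))
    (hΓ : ∀ d a b, HasOrder U K 1 (fun ε => christoffel (g ε) d a b)) {j : ℕ} (hj : 1 ≤ j)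
    (I : Fin j → Fin 4) : Comb U K (nablaOps g) j (partialOps j I) := by
  induction j, hj using Nat.le_induction with
  | base =>
    refine (Comb.basis le_rfl I).congr (Eventually.of_forall fun ε u _ x _ => ?_)
    simp [nablaOps, nablaPow, covD, partialOps, pdPow]
  | succ j hj ih =>
    exact (ih (Fin.tail I)).pd hU hK (preservesSmooth_nablaOps hU hg)
      (comb_pd_nablaOps hU hK hΓ) (I 0)

lemma exists_sum_sq_le {D D' : (i : ℕ) → (Fin i → Fin 4) → ℝ → (Pt → ℝ) → Pt → ℝ} (hK : K ⊆ U)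
    {j : ℕ} (h : ∀ I, Comb U K D j (D' j I)) : ∃ C : ℝ, 0 ≤ C ∧ ∀ᶠ ε in 𝓝[>] (0 : ℝ),
      ∀ u, ContDiffOn ℝ ∞ u U → ∀ x ∈ K, ∑ I, D' j I ε u x ^ 2 ≤
        C * ∑ i ∈ Finset.Icc 1 j, 1 / ε ^ (2 * (j - i)) * ∑ J, D i J ε u x ^ 2 := by
  choose C hC0 hC using fun I => (h I).exists_sq_le hK
  refine ⟨∑ I, C I, Finset.sum_nonneg fun I _ => hC0 I, ?_⟩
  filter_upwards [eventually_all.2 hC] with ε h u hu x hx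
  rw [Finset.sum_mul]
  exact Finset.sum_le_sum fun I _ => h I u hu x hx

end Transition

/-! ### Integration over slices -/

section Slice

variable {U Ω : Set Pt} {g : MatField} {τ : ℝ}

lemma continuous_cons (τ : ℝ) : Continuous fun y : Fin 3 → ℝ => (Fin.cons τ y : Pt) :=
  continuous_pi fun i => by
    refine Fin.cases ?_ (fun j => ?_) i
    · simpa only [Fin.cons_zero] using continuous_const
    · simpa only [Fin.cons_succ] using continuous_apply j

lemma measurableSet_slice (hΩm : MeasurableSet Ω) :
    MeasurableSet {y : Fin 3 → ℝ | (Fin.cons τ y : Pt) ∈ Ω} :=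
  (continuous_cons τ).measurable hΩm

lemma isCompact_slice {K : Set Pt} (hK : IsCompact K) :
    IsCompact {y : Fin 3 → ℝ | (Fin.cons τ y : Pt) ∈ K} := by
  have hc : Continuous fun x : Pt => (Fin.tail x : Fin 3 → ℝ) :=
    continuous_pi fun i => continuous_apply i.succ
  refine (hK.image hc).of_isClosed_subset (hK.isClosed.preimage (continuous_cons τ)) fun y hy => ?_
  exact ⟨_, hy, Fin.tail_cons _ _⟩

/-- The integrand is continuous on the slice of `closure Ω`, which is compact; restrict to the slice
of `Ω`. -/
lemma integrableOn_slice (hg : SmoothField U g) (hΩc : IsCompact (closure Ω))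
    (hΩU : closure Ω ⊆ U) {f : Pt → ℝ} (hf : ContinuousOn f U) :
    IntegrableOn (fun y : Fin 3 → ℝ =>
      f (Fin.cons τ y) * Real.sqrt |(g (Fin.cons τ y)).det|)
      {y : Fin 3 → ℝ | (Fin.cons τ y : Pt) ∈ Ω} := by
  have h1 : ContinuousOn (fun x => f x * Real.sqrt |(g x).det|) U :=
    hf.mul (Real.continuous_sqrt.comp_continuousOn (contDiffOn_det hg).continuousOn.abs)
  have h2 : IntegrableOn (fun y : Fin 3 → ℝ =>
      f (Fin.cons τ y) * Real.sqrt |(g (Fin.cons τ y)).det|)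
      {y : Fin 3 → ℝ | (Fin.cons τ y : Pt) ∈ closure Ω} :=
    (h1.comp (continuous_cons τ).continuousOn fun y hy => hΩU hy).integrableOn_compact
      (isCompact_slice hΩc)
  exact h2.mono_set fun y hy => subset_closure hy

lemma sliceIntegral_mono (hg : SmoothField U g) (hΩm : MeasurableSet Ω)
    (hΩc : IsCompact (closure Ω)) (hΩU : closure Ω ⊆ U) {f h : Pt → ℝ} (hf : ContinuousOn f U)
    (hh : ContinuousOn h U) (hfh : ∀ x ∈ Ω, f x ≤ h x) :
    sliceIntegral g Ω τ f ≤ sliceIntegral g Ω τ h :=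
  setIntegral_mono_on (integrableOn_slice hg hΩc hΩU hf) (integrableOn_slice hg hΩc hΩU hh)
    (measurableSet_slice hΩm) fun _ hy =>
      mul_le_mul_of_nonneg_right (hfh _ hy) (Real.sqrt_nonneg _)

lemma sliceIntegral_nonneg (hΩm : MeasurableSet Ω) {f : Pt → ℝ} (hf : ∀ x ∈ Ω, 0 ≤ f x) :
    0 ≤ sliceIntegral g Ω τ f :=
  setIntegral_nonneg (measurableSet_slice hΩm) fun _ hy =>
    mul_nonneg (hf _ hy) (Real.sqrt_nonneg _)

lemma sliceIntegral_const_mul (c : ℝ) (f : Pt → ℝ) :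
    sliceIntegral g Ω τ (fun x => c * f x) = c * sliceIntegral g Ω τ f := by
  simp only [sliceIntegral, mul_assoc]
  exact integral_const_mul _ _

lemma sliceIntegral_sum (hg : SmoothField U g) (hΩc : IsCompact (closure Ω))
    (hΩU : closure Ω ⊆ U) {ι : Type*} (s : Finset ι) {f : ι → Pt → ℝ}
    (hf : ∀ i ∈ s, ContinuousOn (f i) U) :
    sliceIntegral g Ω τ (fun x => ∑ i ∈ s, f i x) = ∑ i ∈ s, sliceIntegral g Ω τ (f i) := by
  simp only [sliceIntegral, Finset.sum_mul]
  exact integral_finsetSum _ fun i hi => integrableOn_slice hg hΩc hΩU (hf i hi)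

lemma sliceIntegral_le_sum (hg : SmoothField U g) (hΩm : MeasurableSet Ω)
    (hΩc : IsCompact (closure Ω)) (hΩU : closure Ω ⊆ U) {ι : Type*} (s : Finset ι) {C : ℝ}
    {w : ι → ℝ} {Q : Pt → ℝ} {R : ι → Pt → ℝ} (hQ : ContinuousOn Q U)
    (hR : ∀ i, ContinuousOn (R i) U) (h : ∀ x ∈ Ω, Q x ≤ C * ∑ i ∈ s, w i * R i x) :
    sliceIntegral g Ω τ Q ≤ C * ∑ i ∈ s, w i * sliceIntegral g Ω τ (R i) := by
  have hwR : ∀ i ∈ s, ContinuousOn (fun x => w i * R i x) U := fun i _ =>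
    continuousOn_const.mul (hR i)
  refine (sliceIntegral_mono (h := fun x => C * ∑ i ∈ s, w i * R i x) hg hΩm hΩc hΩU hQ
    (continuousOn_const.mul (continuousOn_finsetSum s hwR)) h).trans_eq ?_
  rw [sliceIntegral_const_mul, sliceIntegral_sum hg hΩc hΩU s hwR]
  simp only [sliceIntegral_const_mul]

end Slice

/-! ### Summation over the orders -/

/-- As `ε ≤ 1`, replacing `j` by `k` in the exponent only enlarges the weights, and `r i` is at most
its partial sum. The term `q 0 = r 0` is absorbed by the summand `j = k`, of weight `1`; this
accounts for the `1` in the constant. -/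
lemma sum_range_le_sum_Icc {k : ℕ} (hk : 1 ≤ k) {ε : ℝ} (hε : 0 < ε) (hε1 : ε ≤ 1)
    {q r C : ℕ → ℝ} (hr : ∀ j, 0 ≤ r j) (hC : ∀ j, 0 ≤ C j) (h0 : q 0 = r 0)
    (h : ∀ j, 1 ≤ j → j ≤ k → q j ≤ C j * ∑ i ∈ Finset.Icc 1 j, 1 / ε ^ (2 * (j - i)) * r i) :
    ∑ j ∈ Finset.range (k + 1), q j ≤ (1 + ∑ j ∈ Finset.range (k + 1), C j) *
      ∑ j ∈ Finset.Icc 1 k, 1 / ε ^ (2 * (k - j)) * ∑ i ∈ Finset.range (j + 1), r i := by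
  set S := ∑ j ∈ Finset.Icc 1 k, 1 / ε ^ (2 * (k - j)) * ∑ i ∈ Finset.range (j + 1), r i with hS
  have hr' : ∀ j, 0 ≤ ∑ i ∈ Finset.range (j + 1), r i := fun j =>
    Finset.sum_nonneg fun i _ => hr i
  have hterm : ∀ j ∈ Finset.Icc 1 k,
      0 ≤ 1 / ε ^ (2 * (k - j)) * ∑ i ∈ Finset.range (j + 1), r i := fun j _ =>
    mul_nonneg (by positivity) (hr' j)
  have hS0 : 0 ≤ S := Finset.sum_nonneg hterm
  have hq0 : q 0 ≤ S := by
    rw [h0]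
    refine le_trans ?_ (Finset.single_le_sum hterm (Finset.mem_Icc.2 ⟨hk, le_rfl⟩))
    rw [Nat.sub_self, mul_zero, pow_zero, div_one, one_mul]
    exact Finset.single_le_sum (f := r) (fun i _ => hr i) (Finset.mem_range.2 (Nat.succ_pos k))
  have hq : ∀ j, 1 ≤ j → j ≤ k → q j ≤ C j * S := fun j hj hjk => by
    refine (h j hj hjk).trans (mul_le_mul_of_nonneg_left ?_ (hC j))
    refine le_trans (Finset.sum_le_sum fun i hi => ?_)
      (Finset.sum_le_sum_of_subset_of_nonneg (Finset.Icc_subset_Icc_right hjk)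
        fun i hi _ => hterm i hi)
    refine mul_le_mul ?_ ?_ (hr i) (by positivity)
    · exact one_div_le_one_div_of_le (by positivity)
        (pow_le_pow_of_le_one hε.le hε1 (by omega))
    · exact Finset.single_le_sum (f := r) (fun i _ => hr i)
        (Finset.mem_range.2 (Nat.lt_succ_self i))
  rw [Finset.sum_range_succ', add_mul, one_mul, add_comm, Finset.sum_range_succ' C, add_mul,
    Finset.sum_mul]
  refine add_le_add hq0 (le_add_of_le_of_nonneg ?_ (mul_nonneg (hC 0) hS0))
  exact Finset.sum_le_sum fun j hj =>
    hq (j + 1) (Nat.le_add_left 1 j) (Finset.mem_range.1 hj)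

/-! ### Squared norms and the energy estimate -/

section Norms

variable {U Ω : Set Pt} {g : MatField} {τ : ℝ}

lemma continuousOn_lapse (hg : IsLorentzMetric U g) : ContinuousOn (lapse g) U :=
  (Real.continuous_sqrt.comp_continuousOn (hg.smoothField_inv 0 0).continuousOn.neg).congr
    fun x hx => lapse_eq (hg.2 x hx)

lemma continuousOn_eUp (hg : IsLorentzMetric U g) (h : ∀ x ∈ U, invMetric g x 0 0 < 0)
    (a b : Fin 4) : ContinuousOn (fun x => eUp g x a b) U := by
  have hi := fun a b => (hg.smoothField_inv a b).continuousOn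
  have hx : ∀ a, ContinuousOn (fun x => xiHat g x a) U := fun a => by
    simp only [xiHat, xi_eq]
    exact (hi a 0).neg.div (continuousOn_lapse hg) fun x hx => (lapse_pos (hg.2 x hx) (h x hx)).ne'
  exact (hi a b).add ((continuousOn_const.mul (hx a)).mul (hx b))

/-- Provides the integrability that monotonicity of the slice integrals requires. -/
lemma continuousOn_nablaNormSq (hU : IsOpen U) (hg : IsLorentzMetric U g)
    (h : ∀ x ∈ U, invMetric g x 0 0 < 0) {u : Pt → ℝ} (hu : ContDiffOn ℝ ∞ u U) (j : ℕ) :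
    ContinuousOn (nablaNormSq g u j) U := by
  refine ContinuousOn.congr ?_ fun x hx => nablaNormSq_eq_tensorForm (hg.2 x hx) (h x hx) u j
  exact continuousOn_finsetSum _ fun I _ => continuousOn_finsetSum _ fun J _ =>
    ((continuousOn_finsetProd _ fun s _ => continuousOn_eUp hg h _ _).mul
      (contDiffOn_nablaPow hU hg hu j I).continuousOn).mul
      (contDiffOn_nablaPow hU hg hu j J).continuousOn

lemma covSobolev_sq (hΩm : MeasurableSet Ω) (hg : ∀ x ∈ Ω, IsLorentzMatrix (g x))
    (h : ∀ x ∈ Ω, invMetric g x 0 0 < 0) (k : ℕ) (u : Pt → ℝ) :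
    covSobolev g Ω τ k u ^ 2 =
      ∑ j ∈ Finset.range (k + 1), sliceIntegral g Ω τ (nablaNormSq g u j) :=
  Real.sq_sqrt (Finset.sum_nonneg fun j _ => sliceIntegral_nonneg hΩm fun x hx =>
    nablaNormSq_nonneg (hg x hx) (h x hx) u j)

/-- The sum of the squares of the partial derivatives of order `j`. -/
noncomputable def partialNormSq (u : Pt → ℝ) (j : ℕ) (x : Pt) : ℝ :=
  ∑ p : Fin j → Fin 4, pdPow u j p x ^ 2

lemma partialNormSq_nonneg (u : Pt → ℝ) (j : ℕ) (x : Pt) : 0 ≤ partialNormSq u j x :=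
  Finset.sum_nonneg fun _ _ => sq_nonneg _

lemma continuousOn_partialNormSq (hU : IsOpen U) {u : Pt → ℝ} (hu : ContDiffOn ℝ ∞ u U) (j : ℕ) :
    ContinuousOn (partialNormSq u j) U :=
  continuousOn_finsetSum _ fun p _ => (contDiffOn_pdPow hU hu j p).continuousOn.pow 2

lemma partialSobolev_sq (hU : IsOpen U) (hg : SmoothField U g) (hΩm : MeasurableSet Ω)
    (hΩc : IsCompact (closure Ω)) (hΩU : closure Ω ⊆ U) (k : ℕ) {u : Pt → ℝ}
    (hu : ContDiffOn ℝ ∞ u U) :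
    partialSobolev g Ω τ k u ^ 2 =
      ∑ j ∈ Finset.range (k + 1), sliceIntegral g Ω τ (partialNormSq u j) := by
  rw [partialSobolev, Real.sq_sqrt (Finset.sum_nonneg fun j _ => Finset.sum_nonneg fun p _ =>
    sliceIntegral_nonneg hΩm fun x _ => sq_nonneg _)]
  refine Finset.sum_congr rfl fun j _ => ?_
  simp only [sq_abs]
  exact (sliceIntegral_sum hg hΩc hΩU _ fun p _ =>
    (contDiffOn_pdPow hU hu j p).continuousOn.pow 2).symm

lemma continuousOn_energyDensity (hU : IsOpen U) (hg : IsLorentzMetric U g)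
    (h : ∀ x ∈ U, invMetric g x 0 0 < 0) {u : Pt → ℝ} (hu : ContDiffOn ℝ ∞ u U) (j : ℕ) :
    ContinuousOn (fun x => ∑ a, ∑ b, energyTensor g u j x a b * sigma a * sigmaHat g x b) U :=
  (((continuousOn_lapse hg).div_const 2).mul (continuousOn_nablaNormSq hU hg h hu j)).congr
    fun x hx => energyDensity_eq (hg.2 x hx) (h x hx) u j

/-- Each summand `j` has the same pointwise factor `V/2`, so the constants are independent of `k`.
-/
lemma energy_bounds (hU : IsOpen U) (hg : IsLorentzMetric U g)
    (h : ∀ x ∈ U, invMetric g x 0 0 < 0) (hΩm : MeasurableSet Ω)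
    (hΩc : IsCompact (closure Ω)) (hΩU : closure Ω ⊆ U) {c c' : ℝ}
    (hV : ∀ x ∈ Ω, c' ≤ lapse g x ∧ lapse g x ≤ c) {u : Pt → ℝ} (hu : ContDiffOn ℝ ∞ u U)
    (k : ℕ) :
    c' / 2 * covSobolev g Ω τ k u ^ 2 ≤ energy g Ω τ k u ∧
      energy g Ω τ k u ≤ c / 2 * covSobolev g Ω τ k u ^ 2 := by
  have hΩ : ∀ x ∈ Ω, x ∈ U := fun x hx => hΩU (subset_closure hx)
  have hN := continuousOn_nablaNormSq hU hg h hu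
  have hE := continuousOn_energyDensity hU hg h hu
  rw [covSobolev_sq hΩm (fun x hx => hg.2 x (hΩ x hx)) (fun x hx => h x (hΩ x hx)), energy,
    Finset.mul_sum, Finset.mul_sum]
  constructor
  · refine Finset.sum_le_sum fun j _ => ?_
    rw [← sliceIntegral_const_mul]
    refine sliceIntegral_mono hg.1 hΩm hΩc hΩU (continuousOn_const.mul (hN j)) (hE j)
      fun x hx => ?_
    rw [energyDensity_eq (hg.2 x (hΩ x hx)) (h x (hΩ x hx))]
    exact mul_le_mul_of_nonneg_right (by linarith [(hV x hx).1])
      (nablaNormSq_nonneg (hg.2 x (hΩ x hx)) (h x (hΩ x hx)) u j)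
  · refine Finset.sum_le_sum fun j _ => ?_
    rw [← sliceIntegral_const_mul]
    refine sliceIntegral_mono hg.1 hΩm hΩc hΩU (hE j) (continuousOn_const.mul (hN j))
      fun x hx => ?_
    rw [energyDensity_eq (hg.2 x (hΩ x hx)) (h x (hΩ x hx))]
    exact mul_le_mul_of_nonneg_right (by linarith [(hV x hx).2])
      (nablaNormSq_nonneg (hg.2 x (hΩ x hx)) (h x (hΩ x hx)) u j)

lemma partialNormSq_zero (u : Pt → ℝ) (x : Pt) : partialNormSq u 0 x = u x ^ 2 := by
  simp [partialNormSq, pdPow]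

lemma covSobolev_zero (g : MatField) (Ω : Set Pt) (τ : ℝ) (u : Pt → ℝ) :
    covSobolev g Ω τ 0 u = partialSobolev g Ω τ 0 u := by
  have h : nablaNormSq g u 0 = fun x => |u x| ^ 2 := by
    funext x
    rw [nablaNormSq_zero, sq_abs]
  simp [covSobolev, partialSobolev, h, pdPow]

end Norms

/-! ### Bounds uniform in `ε` for the lapse and for `e` -/

section Uniform

variable {U K : Set Pt} {g : ℝ → MatField}

lemma exists_uniform_bound {ι : Type*} [Finite ι] {f : ι → ℝ → Pt → ℝ}
    (hf : ∀ i, HasOrder U K 0 (f i)) :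
    ∃ c : ℝ, 0 < c ∧ ∀ᶠ ε in 𝓝[>] (0 : ℝ), ∀ x ∈ K, ∀ i, |f i ε x| ≤ c := by
  choose C hC using fun i => (hf i).bound
  obtain ⟨M, hM⟩ := Finite.bddAbove_range C
  refine ⟨max M 1, lt_max_of_lt_right one_pos, ?_⟩
  filter_upwards [eventually_all.2 hC] with ε h x hx i
  have := h i x hx
  rw [pow_zero, div_one] at this
  exact this.trans ((hM ⟨i, rfl⟩).trans (le_max_left _ _))

lemma inv_le_lapse {g : MatField} {x : Pt} {M₀ : ℝ} (hg : IsLorentzMatrix (g x))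
    (h : invMetric g x 0 0 ≤ -1 / M₀ ^ 2) : 1 / M₀ ≤ lapse g x := by
  rw [lapse_eq hg]
  refine Real.le_sqrt_of_sq_le ?_
  rw [div_pow, one_pow]
  rw [neg_div] at h
  linarith

/-- Here `ξ̂^a = -g^{a0}/V` with `1/V ≤ M₀`. -/
lemma abs_eUp_le {g : MatField} {x : Pt} {M₀ c : ℝ} (hM₀ : 0 < M₀) (hg : IsLorentzMatrix (g x))
    (h : invMetric g x 0 0 ≤ -1 / M₀ ^ 2) (hc : ∀ a b, |invMetric g x a b| ≤ c) (a b : Fin 4) :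
    |eUp g x a b| ≤ c + 2 * (c * M₀) * (c * M₀) := by
  have hV := inv_le_lapse hg h
  have hV0 : 0 < lapse g x := lt_of_lt_of_le (by positivity) hV
  have hc0 : 0 ≤ c := (abs_nonneg _).trans (hc 0 0)
  have hx : ∀ a, |xiHat g x a| ≤ c * M₀ := fun a => by
    rw [xiHat, xi_eq, abs_div, abs_neg, abs_of_pos hV0, div_le_iff₀ hV0]
    refine (hc a 0).trans ?_
    have : 1 ≤ M₀ * lapse g x := by
      rw [div_le_iff₀ hM₀] at hV
      linarith
    rw [mul_assoc]
    exact le_mul_of_one_le_right hc0 this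
  refine (abs_add_le _ _).trans (add_le_add (hc a b) ?_)
  rw [abs_mul, abs_mul, abs_two]
  have := hx a
  have := hx b
  gcongr

lemma abs_eMetric_le {g : MatField} {x : Pt} {M₀ c : ℝ} (hM₀ : 0 < M₀)
    (hg : IsLorentzMatrix (g x)) (h : invMetric g x 0 0 ≤ -1 / M₀ ^ 2)
    (hc : ∀ a b, |g x a b| ≤ c) (a b : Fin 4) : |eMetric g x a b| ≤ c + 2 * M₀ * M₀ := by
  have hV := inv_le_lapse hg h
  have hV0 : 0 < lapse g x := lt_of_lt_of_le (by positivity) hV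
  have hx : ∀ a, |sigmaHat g x a| ≤ M₀ := fun a => by
    rw [sigmaHat_eq hg, abs_div, abs_of_pos hV0, div_le_iff₀ hV0]
    have h1 : 1 ≤ M₀ * lapse g x := by
      rw [div_le_iff₀ hM₀] at hV
      linarith
    refine le_trans ?_ h1
    by_cases ha : a = 0
    · simp [ha, sigma_zero]
    · simp [sigma_of_ne ha]
  refine (abs_add_le _ _).trans (add_le_add (hc a b) ?_)
  rw [abs_mul, abs_mul, abs_two]
  have := hx a
  have := hx b
  gcongr

end Uniform

/-! ### Pointwise comparison of the two families of derivatives -/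

section Comparison

variable {U K : Set Pt} {g : ℝ → MatField}

lemma exists_nablaNormSq_le {D : (i : ℕ) → (Fin i → Fin 4) → ℝ → (Pt → ℝ) → Pt → ℝ} (hK : K ⊆ U)
    {j : ℕ} (hcomb : ∀ I, Comb U K D j (nablaOps g j I)) {c : ℝ} (hc0 : 0 ≤ c)
    (hc : ∀ᶠ ε in 𝓝[>] (0 : ℝ), ∀ x ∈ K, IsLorentzMatrix (g ε x) ∧
      invMetric (g ε) x 0 0 < 0 ∧ ∀ a b, |eUp (g ε) x a b| ≤ c) :
    ∃ C : ℝ, 0 ≤ C ∧ ∀ᶠ ε in 𝓝[>] (0 : ℝ), ∀ u, ContDiffOn ℝ ∞ u U → ∀ x ∈ K,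
      nablaNormSq (g ε) u j x ≤
        C * ∑ i ∈ Finset.Icc 1 j, 1 / ε ^ (2 * (j - i)) * ∑ J, D i J ε u x ^ 2 := by
  obtain ⟨C, hC0, hC⟩ := exists_sum_sq_le hK hcomb
  refine ⟨(16 * c) ^ j * C, by positivity, ?_⟩
  filter_upwards [hc, hC] with ε h1 h2 u hu x hx
  obtain ⟨hg, hneg, hb⟩ := h1 x hx
  rw [nablaNormSq_eq_tensorForm hg hneg, mul_assoc]
  exact (tensorForm_le (eUp_posSemidef hg hneg) hb _).trans
    (mul_le_mul_of_nonneg_left (h2 u hu x hx) (by positivity))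

lemma exists_partialNormSq_le (hK : K ⊆ U) {j : ℕ}
    (hcomb : ∀ I, Comb U K (nablaOps g) j (partialOps j I)) {c : ℝ} (hc0 : 0 ≤ c)
    (hc : ∀ᶠ ε in 𝓝[>] (0 : ℝ), ∀ x ∈ K, IsLorentzMatrix (g ε x) ∧
      invMetric (g ε) x 0 0 < 0 ∧ ∀ a b, |eMetric (g ε) x a b| ≤ c) :
    ∃ C : ℝ, 0 ≤ C ∧ ∀ᶠ ε in 𝓝[>] (0 : ℝ), ∀ u, ContDiffOn ℝ ∞ u U → ∀ x ∈ K,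
      partialNormSq u j x ≤
        C * ∑ i ∈ Finset.Icc 1 j, 1 / ε ^ (2 * (j - i)) * nablaNormSq (g ε) u i x := by
  obtain ⟨C, hC0, hC⟩ := exists_sum_sq_le hK hcomb
  -- Comparing components with the `e`-norm costs `(16 c)^i`, which depends on `i`; the sum
  -- dominates every such factor.
  refine ⟨C * ∑ i ∈ Finset.range (j + 1), (16 * c) ^ i,
    mul_nonneg hC0 (Finset.sum_nonneg fun i _ => by positivity), ?_⟩
  filter_upwards [hc, hC, self_mem_nhdsWithin] with ε h1 h2 (hε : 0 < ε) u hu x hx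
  obtain ⟨hg, hneg, hb⟩ := h1 x hx
  refine (h2 u hu x hx).trans ?_
  rw [mul_assoc]
  refine mul_le_mul_of_nonneg_left ?_ hC0
  rw [Finset.mul_sum]
  refine Finset.sum_le_sum fun i hi => ?_
  rw [mul_left_comm]
  refine mul_le_mul_of_nonneg_left ?_ (by positivity)
  have h3 := sum_sq_le_tensorForm (eUp_posSemidef hg hneg)
    (mul_eq_one_comm.1 (eMetric_mul_eUp hg hneg)) hb (fun I => nablaPow (g ε) u i I x)
  rw [← nablaNormSq_eq_tensorForm hg hneg] at h3
  refine h3.trans (mul_le_mul_of_nonneg_right ?_ (nablaNormSq_nonneg hg hneg u i))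
  exact Finset.single_le_sum (f := fun i => (16 * c) ^ i) (fun i _ => by positivity)
    (Finset.mem_range.2 (Nat.lt_succ_of_le (Finset.mem_Icc.1 hi).2))

end Comparison

end EnergySobolev

/-! ### The lemma -/

open EnergySobolev
theorem lemma1
    (U : Set Pt) (hU : IsOpen U)
    (m : MatField) (hm : IsRiemannMetric U m)
    (g : ℝ → MatField) (hg : ∀ ε ∈ Set.Ioc (0 : ℝ) 1, IsLorentzMetric U (g ε))
    (M₀ : ℝ) (hM₀ : 0 < M₀)
    (hdt : ∀ᶠ ε in 𝓝[>] (0 : ℝ), ∀ x ∈ U, invMetricDt (g ε) x ≤ -1 / M₀ ^ 2)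
    (hA : ConditionA U m g)
    (Ω : Set Pt) (hΩm : MeasurableSet Ω) (hΩc : IsCompact (closure Ω)) (hΩU : closure Ω ⊆ U)
    (γ : ℝ) (hγ : 0 < γ) :
    (∃ A A' : ℝ, 0 < A ∧ 0 < A' ∧ ∀ᶠ ε in 𝓝[>] (0 : ℝ),
      ∀ (k : ℕ), ∀ τ ∈ Set.Icc 0 γ, ∀ u : Pt → ℝ, ContDiffOn ℝ ∞ u U →
        A' * covSobolev (g ε) Ω τ k u ^ 2 ≤ energy (g ε) Ω τ k u ∧
        energy (g ε) Ω τ k u ≤ A * covSobolev (g ε) Ω τ k u ^ 2) ∧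
    (∀ k : ℕ, 1 ≤ k → ∃ B B' : ℝ, 0 < B ∧ 0 < B' ∧ ∀ᶠ ε in 𝓝[>] (0 : ℝ),
      ∀ τ ∈ Set.Icc 0 γ, ∀ u : Pt → ℝ, ContDiffOn ℝ ∞ u U →
        covSobolev (g ε) Ω τ k u ^ 2 ≤
          B' * ∑ j ∈ Finset.Icc 1 k,
            1 / ε ^ (2 * (k - j)) * partialSobolev (g ε) Ω τ j u ^ 2 ∧
        partialSobolev (g ε) Ω τ k u ^ 2 ≤
          B * ∑ j ∈ Finset.Icc 1 k,
            1 / ε ^ (2 * (k - j)) * covSobolev (g ε) Ω τ j u ^ 2) ∧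
    (∀ ε ∈ Set.Ioc (0 : ℝ) 1, ∀ τ ∈ Set.Icc 0 γ, ∀ u : Pt → ℝ, ContDiffOn ℝ ∞ u U →
      covSobolev (g ε) Ω τ 0 u ^ 2 = partialSobolev (g ε) Ω τ 0 u ^ 2) := by
  have hgl := eventually_isLorentzMetric hg
  have hd := hasOrder_metric hU hm hgl hA hΩc hΩU
  have hi := hasOrder_invMetric hU hm hgl hA hΩc hΩU
  have hΓ := hasOrder_christoffel hU hΩU hd hi
  simp only [invMetricDt_eq] at hdt
  have hM : -1 / M₀ ^ 2 < 0 := div_neg_of_neg_of_pos (by norm_num) (by positivity)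
  have hneg : ∀ᶠ ε in 𝓝[>] (0 : ℝ), ∀ x ∈ U, invMetric (g ε) x 0 0 < 0 :=
    hdt.mono fun ε h x hx => (h x hx).trans_lt hM
  obtain ⟨c, hc0, hc⟩ := exists_uniform_bound (fun p : Fin 4 × Fin 4 => hd p.1 p.2)
  obtain ⟨c', hc0', hc'⟩ := exists_uniform_bound (fun p : Fin 4 × Fin 4 => hi p.1 p.2)
  have hΩ : ∀ x ∈ Ω, x ∈ U := fun x hx => hΩU (subset_closure hx)
  -- Half the upper and lower bounds of the lapse, where `c'` bounds the entries of `g⁻¹`.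
  refine ⟨⟨Real.sqrt c' / 2, 1 / M₀ / 2, by positivity, by positivity, ?_⟩, fun k hk => ?_,
    fun ε _ τ _ u _ => by rw [covSobolev_zero]⟩
  · filter_upwards [hgl, hdt, hneg, hc'] with ε h1 h2 h3 h4 k τ _ u hu
    refine energy_bounds hU h1 h3 hΩm hΩc hΩU (fun x hx => ⟨?_, ?_⟩) hu k
    · exact inv_le_lapse (h1.2 x (hΩ x hx)) (h2 x (hΩ x hx))
    · rw [lapse_eq (h1.2 x (hΩ x hx))]
      exact Real.sqrt_le_sqrt ((neg_le_abs _).trans (h4 x (subset_closure hx) (0, 0)))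
  · have hup : ∀ᶠ ε in 𝓝[>] (0 : ℝ), ∀ x ∈ closure Ω, IsLorentzMatrix (g ε x) ∧
        invMetric (g ε) x 0 0 < 0 ∧
        ∀ a b, |eUp (g ε) x a b| ≤ c' + 2 * (c' * M₀) * (c' * M₀) := by
      filter_upwards [hgl, hdt, hneg, hc'] with ε h1 h2 h3 h4 x hx
      exact ⟨h1.2 x (hΩU hx), h3 x (hΩU hx), abs_eUp_le hM₀ (h1.2 x (hΩU hx)) (h2 x (hΩU hx))
        fun a b => h4 x hx (a, b)⟩
    have hdown : ∀ᶠ ε in 𝓝[>] (0 : ℝ), ∀ x ∈ closure Ω, IsLorentzMatrix (g ε x) ∧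
        invMetric (g ε) x 0 0 < 0 ∧ ∀ a b, |eMetric (g ε) x a b| ≤ c + 2 * M₀ * M₀ := by
      filter_upwards [hgl, hdt, hneg, hc] with ε h1 h2 h3 h4 x hx
      exact ⟨h1.2 x (hΩU hx), h3 x (hΩU hx), abs_eMetric_le hM₀ (h1.2 x (hΩU hx))
        (h2 x (hΩU hx)) fun a b => h4 x hx (a, b)⟩
    -- The condition `1 ≤ j` is placed inside so that `choose` yields constants for all `j`; the
    -- value at `j = 0` is a dummy.
    have hN : ∀ j, ∃ C : ℝ, 0 ≤ C ∧ (1 ≤ j → ∀ᶠ ε in 𝓝[>] (0 : ℝ), ∀ u, ContDiffOn ℝ ∞ u U →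
        ∀ x ∈ closure Ω, nablaNormSq (g ε) u j x ≤
          C * ∑ i ∈ Finset.Icc 1 j, 1 / ε ^ (2 * (j - i)) * partialNormSq u i x) := fun j => by
      by_cases hj : 1 ≤ j
      · obtain ⟨C, hC0, hC⟩ := exists_nablaNormSq_le hΩU (comb_nablaOps hU hΩU hΓ hj)
          (by positivity) hup
        exact ⟨C, hC0, fun _ => hC⟩
      · exact ⟨0, le_rfl, fun h => absurd h hj⟩
    have hP : ∀ j, ∃ C : ℝ, 0 ≤ C ∧ (1 ≤ j → ∀ᶠ ε in 𝓝[>] (0 : ℝ), ∀ u, ContDiffOn ℝ ∞ u U →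
        ∀ x ∈ closure Ω, partialNormSq u j x ≤
          C * ∑ i ∈ Finset.Icc 1 j, 1 / ε ^ (2 * (j - i)) * nablaNormSq (g ε) u i x) :=
      fun j => by
      by_cases hj : 1 ≤ j
      · obtain ⟨C, hC0, hC⟩ := exists_partialNormSq_le hΩU (comb_partialOps hU hΩU hgl hΓ hj)
          (by positivity) hdown
        exact ⟨C, hC0, fun _ => hC⟩
      · exact ⟨0, le_rfl, fun h => absurd h hj⟩
    choose C hC0 hC using hN
    choose C' hC0' hC' using hP
    -- Only finitely many `j ≤ k` occur, so one range of `ε`, depending on `k`, serves them all.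
    have hCk := (Finset.eventually_all (Finset.Icc 1 k)).2 fun j hj => hC j (Finset.mem_Icc.1 hj).1
    have hCk' := (Finset.eventually_all (Finset.Icc 1 k)).2 fun j hj =>
      hC' j (Finset.mem_Icc.1 hj).1
    refine ⟨1 + ∑ j ∈ Finset.range (k + 1), C' j, 1 + ∑ j ∈ Finset.range (k + 1), C j,
      add_pos_of_pos_of_nonneg one_pos (Finset.sum_nonneg fun j _ => hC0' j),
      add_pos_of_pos_of_nonneg one_pos (Finset.sum_nonneg fun j _ => hC0 j), ?_⟩
    filter_upwards [hgl, hneg, hCk, hCk', Ioc_mem_nhdsGT (zero_lt_one' ℝ)] with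
      ε h1 h2 h3 h4 hε τ _ u hu
    have hgΩ : ∀ x ∈ Ω, IsLorentzMatrix (g ε x) := fun x hx => h1.2 x (hΩ x hx)
    have hnΩ : ∀ x ∈ Ω, invMetric (g ε) x 0 0 < 0 := fun x hx => h2 x (hΩ x hx)
    have hcN := continuousOn_nablaNormSq hU h1 h2 hu
    have hcP := continuousOn_partialNormSq hU hu
    have h0 : sliceIntegral (g ε) Ω τ (nablaNormSq (g ε) u 0) =
        sliceIntegral (g ε) Ω τ (partialNormSq u 0) := by
      congr 1
      funext x
      rw [nablaNormSq_zero, partialNormSq_zero]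
    simp only [covSobolev_sq hΩm hgΩ hnΩ, partialSobolev_sq hU h1.1 hΩm hΩc hΩU _ hu]
    constructor
    · refine sum_range_le_sum_Icc hk hε.1 hε.2
        (fun j => sliceIntegral_nonneg hΩm fun x _ => partialNormSq_nonneg u j x) hC0 h0
        fun j hj hjk => ?_
      exact sliceIntegral_le_sum h1.1 hΩm hΩc hΩU _ (hcN j) hcP fun x hx =>
        h3 j (Finset.mem_Icc.2 ⟨hj, hjk⟩) u hu x (subset_closure hx)
    · refine sum_range_le_sum_Icc hk hε.1 hε.2
        (fun j => sliceIntegral_nonneg hΩm fun x hx =>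
          nablaNormSq_nonneg (hgΩ x hx) (hnΩ x hx) u j) hC0' h0.symm fun j hj hjk => ?_
      exact sliceIntegral_le_sum h1.1 hΩm hΩc hΩU _ (hcP j) hcN fun x hx =>
        h4 j (Finset.mem_Icc.2 ⟨hj, hjk⟩) u hu x (subset_closure hx)
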